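/- Let $n=em$ with integers $e\ge 2$, $m\ge 2$, and let $\rho$ be an integer with $1\le\rho<\lfloor n/2\rfloor$. Let $f\in\mathbb Z_4[x]$ be monic of degree $n$ with primitive reduction modulo $2$, and let $GR(4,n)=\mathbb Z_4[x]/(f)$. Let $G_C$ be the cyclic subgroup of order $2^n-1$ of its unit group, let $\beta$ be a generator of $G_C$, and put $T=G_C\cup\{0\}$. Every $x\in GR(4,n)$ is uniquely $x=x_0+2x_1$ with $x_0,x_1\in T$; for $e'\mid n$ let $\sigma_{e'}(x)=x_0^{2^{e'}}+2x_1^{2^{e'}}$ and let $GR(4,e')\subseteq GR(4,n)$ be the subring of fixed points of $\sigma_{e'}$. For $k\mid n$ let $Tr_1^k(x)=\sum_{i=0}^{k-1}\sigma_1^i(x)$. The bar denotes reduction modulo $2$, $GR(4,n)\to GF(2^n)$. Fix $\lambda\in GR(4,e)$ with $\overline\lambda\notin\{0,1\}$. For $x\in GR(4,n)$ put $$P(x)=\begin{cases}\sum_{j=1}^{m/2-1}Tr_1^n(x^{2^{ej}+1})+Tr_1^{n/2}(x^{2^{n/2}+1}), & m \text{ even},\\ \sum_{j=1}^{(m-1)/2}Tr_1^n(x^{2^{ej}+1}),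 & m\text{ odd}.\end{cases}$$ For $\lambda_0\in T$ and $\Lambda=(\lambda_1,\dots,\lambda_{\rho-1})\in T^{\rho-1}$ let $$s(\lambda_0,\Lambda,t)=Tr_1^n[(1+2\lambda_0)\beta^t]+2\sum_{k=1}^{\rho-1}Tr_1^n(\lambda_k\beta^{t(1+2^k)})+2P(\lambda\beta^t),\qquad t\ge 0 .$$ The family $\mathcal L$ consists of these sequences and the additional sequence $2Tr_1^n(\beta^t)$; all of them take values in $\mathbb Z_4\subseteq GR(4,n)$. The linear span of a quaternary sequence is the length of the shortest linear feedback shift register over $\mathbb Z_4$ that generates it. Let $B$ be the set of multiples of $e$ in $\{1,\dots,\rho-1\}$ and $A=\{1,\dots,\rho-1\}\setminus B$, so that $|B|=\lfloor\frac{\rho-1}{e}\rfloor$ and $|A|=\rho-1-\lfloor\frac{\rho-1}{e}\rfloor$. (1) Let $0\le j\le|A|$ and $0\le l\le |B|$. If exactly $j$ of the $\lambda_i$ with $i\in A$ are equal to $0$ and exactly $l$ of the $\lambda_i$ with $i\in B$ satisfy $\overline{\lambda_i}=\overline\lambda^{\,2^i+1}$, then the sequence $s(\lambda_0,\Lambda,t)$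 has linear span $$LS_{j,l}(\rho)=n\left(\frac{m-1}{2}+\rho-1-\left\lfloor\frac{\rho-1}{e}\right\rfloor+1-j-l\right),$$ and the number of (distinct) sequences obtained from all such $\lambda_0,\Lambda$ is $$\binom{\rho-1-\lfloor\frac{\rho-1}{e}\rfloor}{j}\binom{\lfloor\frac{\rho-1}{e}\rfloor}{l}2^n(2^n-1)^{\rho-1-j-l}.$$ (2) The sequence $2Tr_1^n(\beta^t)$ has linear span $n$. -/

import Mathlib

open Polynomial

/-! Galois rings, quaternary sequences and their linear span. -/

namespace QuadSeq

/-- A polynomial over `ℤ/2` is primitive if it is irreducible and its root generates the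
multiplicative group of the field it defines. -/
def IsPrimitivePoly (g : (ZMod 2)[X]) : Prop :=
  Irreducible g ∧ orderOf (AdjoinRoot.root g) = 2 ^ g.natDegree - 1

/-- Reduction `ℤ/4 → ℤ/2`. -/
def mod2 : ZMod 4 →+* ZMod 2 := ZMod.castHom (by decide : 2 ∣ 4) (ZMod 2)

/-- A monic polynomial over `ℤ/4` is basic primitive if its reduction modulo `2` is primitive. -/
def IsBasicPrimitive (f : (ZMod 4)[X]) : Prop :=
  f.Monic ∧ IsPrimitivePoly (f.map mod2)

/-- The Galois ring `GR(4, n) = ℤ₄[x]/(f)`, for `f` basic primitive of degree `n`. -/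
abbrev GR (f : (ZMod 4)[X]) : Type := AdjoinRoot f

section Ring

variable {R : Type*} [CommRing R]

/-- The cyclic group `G_C` of order `2 ^ n - 1` in the unit group of `GR(4, n)`. -/
abbrev groupC (R : Type*) [CommRing R] (n : ℕ) : Subgroup Rˣ := rootsOfUnity (2 ^ n - 1) R

/-- `G_C ∪ {0}`, the set of `2 ^ n` digits of the `2`-adic representation. -/
def digits (R : Type*) [CommRing R] (n : ℕ) : Set R :=
  {x | x = 0 ∨ ∃ u ∈ groupC R n, (u : R) = x}

/-- `p = (x₀, x₁)` is the `2`-adic representation `x = x₀ + 2 x₁` of `x`. -/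
def IsTwoAdic (n : ℕ) (x : R) (p : R × R) : Prop :=
  p.1 ∈ digits R n ∧ p.2 ∈ digits R n ∧ x = p.1 + 2 * p.2

/-- The pair of `2`-adic digits of `x`. -/
noncomputable def twoAdic (n : ℕ) (x : R) : R × R := Classical.epsilon (IsTwoAdic n x)

/-- The Frobenius automorphism `x₀ + 2 x₁ ↦ x₀ ^ (2 ^ e) + 2 x₁ ^ (2 ^ e)` over `GR(4, e)`. -/
noncomputable def frob (n e : ℕ) (x : R) : R :=
  (twoAdic n x).1 ^ 2 ^ e + 2 * (twoAdic n x).2 ^ 2 ^ e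

/-- The subring `GR(4, e)` of `GR(4, n)`, for `e ∣ n`. -/
def subGR (R : Type*) [CommRing R] (n e : ℕ) : Set R := {x | frob n e x = x}

/-- The trace `x + σ x + ⋯ + σ ^ (k - 1) x` from `GR(4, k)` to `ℤ₄`, for `k ∣ n`, where `σ` is
the Frobenius automorphism over `ℤ₄`. -/
noncomputable def tr (n k : ℕ) (x : R) : R := ∑ i ∈ Finset.range k, (frob n 1)^[i] x

/-- The function `P` on `GR(4, n)`, `n = e m`. -/
noncomputable def P (e m : ℕ) (x : R) : R :=
  if Even m then
    ∑ j ∈ Finset.Icc 1 (m / 2 - 1), tr (e * m) (e * m) (x ^ (2 ^ (e * j) + 1))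
      + tr (e * m) (m / 2 * e) (x ^ (2 ^ (m / 2 * e) + 1))
  else
    ∑ j ∈ Finset.Icc 1 (m / 2), tr (e * m) (e * m) (x ^ (2 ^ (e * j) + 1))

/-- The value at `t` of the sequence `s(λ₀, Λ, ·)`, as an element of `ℤ₄ ⊆ GR(4, n)`. -/
noncomputable def s (e m ρ : ℕ) (β lam lam0 : R) (Lam : ℕ → R) (t : ℕ) : R :=
  tr (e * m) (e * m) ((1 + 2 * lam0) * β ^ t)
    + 2 * ∑ k ∈ Finset.Icc 1 (ρ - 1), tr (e * m) (e * m) (Lam k * β ^ (t * (1 + 2 ^ k)))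
    + 2 * P e m (lam * β ^ t)

/-- The value at `t` of the additional sequence `2 Tr(β ^ t)`. -/
noncomputable def sExtra (e m : ℕ) (β : R) (t : ℕ) : R := 2 * tr (e * m) (e * m) (β ^ t)

/-- Reduction modulo `2`, from `GR(4, n)` to its residue field `GF(2 ^ n)`. -/
abbrev red (R : Type*) [CommRing R] : R →+* R ⧸ Ideal.span {(2 : R)} :=
  Ideal.Quotient.mk (Ideal.span {(2 : R)})

end Ring

/-- The multiples of `e` among `1, …, ρ - 1`. -/
def setB (e ρ : ℕ) : Finset ℕ := (Finset.Icc 1 (ρ - 1)).filter (fun k => e ∣ k)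

/-- The other indices among `1, …, ρ - 1`. -/
def setA (e ρ : ℕ) : Finset ℕ := (Finset.Icc 1 (ρ - 1)).filter (fun k => ¬ e ∣ k)

section Ring

variable {R : Type*} [CommRing R]

open Classical in
/-- The parameters `λ₀, λ₁, …, λ_{ρ-1}` lie in `G_C ∪ {0}`; exactly `j` of the `λ_i` with `i ∈ A`
are `0`, and exactly `l` of the `λ_i` with `i ∈ B` reduce to the special value
`λ ^ (2 ^ i + 1)` modulo `2`. -/
def HasType (e m ρ : ℕ) (lam : R) (j l : ℕ) (lam0 : R) (Lam : ℕ → R) : Prop :=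
  lam0 ∈ digits R (e * m) ∧ (∀ k ∈ Finset.Icc 1 (ρ - 1), Lam k ∈ digits R (e * m)) ∧
  ((setA e ρ).filter (fun i => Lam i = 0)).card = j ∧
  ((setB e ρ).filter (fun i => red R (Lam i) = red R lam ^ (2 ^ i + 1))).card = l

/-- The quaternary sequence `a` is the sequence `b` of elements of `ℤ₄ ⊆ R`. -/
def Represents [Algebra (ZMod 4) R] (a : ℕ → ZMod 4) (b : ℕ → R) : Prop :=
  ∀ t, algebraMap (ZMod 4) R (a t) = b t

end Ring

/-- The linear span of a quaternary sequence: the length of the shortest linear feedback shift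
register over `ℤ₄` that generates it. -/
noncomputable def linearSpan (a : ℕ → ZMod 4) : ℕ :=
  sInf {L | ∃ E : LinearRecurrence (ZMod 4), E.order = L ∧ E.IsSolution a}


/-! Every element of `GR(4, n)` has a unique `2`-adic representation. -/

theorem two_dvd_of_mod2 : ∀ a : ZMod 4, mod2 a = 0 → ∃ b, a = 2 * b := by
  unfold mod2; decide

theorem poly_two_dvd {p : (ZMod 4)[X]} (h : p.map mod2 = 0) : ∃ q, p = 2 * q := by
  have hc : ∀ a ∈ p.coeffs, ∃ b, a = 2 * b := fun a ha => by
    obtain ⟨k, -, rfl⟩ := Polynomial.mem_coeffs_iff.1 ha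
    apply two_dvd_of_mod2
    rw [← Polynomial.coeff_map, h, Polynomial.coeff_zero]
  have : (C 2 : (ZMod 4)[X]) ∣ p := by
    rw [Polynomial.C_dvd_iff_dvd_coeff]
    intro i
    by_cases hi : p.coeff i = 0
    · rw [hi]; exact dvd_zero _
    · obtain ⟨b, hb⟩ := hc _ (Polynomial.coeff_mem_coeffs hi)
      exact ⟨b, hb⟩
  obtain ⟨q, hq⟩ := this
  exact ⟨q, by rw [hq, map_ofNat C 2]⟩

theorem gr_four {f : (ZMod 4)[X]} : (4 : GR f) = 0 := by
  have h : (4 : ZMod 4) = 0 := by decide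
  have := congrArg (AdjoinRoot.of f) h
  rwa [map_ofNat (AdjoinRoot.of f) 4, map_zero] at this

/-- Reduction modulo `2` of the Galois ring, into the field defined by the reduced polynomial. -/
noncomputable def toField (f : (ZMod 4)[X]) : GR f →+* AdjoinRoot (f.map mod2) :=
  AdjoinRoot.map mod2 f (f.map mod2) dvd_rfl

theorem toField_mk (f p : (ZMod 4)[X]) :
    toField f (AdjoinRoot.mk f p) = AdjoinRoot.mk (f.map mod2) (p.map mod2) := by
  have : (toField f).comp (AdjoinRoot.mk f) =
      (AdjoinRoot.mk (f.map mod2)).comp (Polynomial.mapRingHom mod2) := by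
    apply Polynomial.ringHom_ext
    · intro a; simp [toField]
    · simp [toField]
  exact congrArg (fun g => g p) this

theorem toField_eq_zero {f : (ZMod 4)[X]} {x : GR f} (h : toField f x = 0) :
    ∃ y, x = 2 * y := by
  obtain ⟨p, rfl⟩ := AdjoinRoot.mk_surjective x
  rw [toField_mk, AdjoinRoot.mk_eq_zero] at h
  obtain ⟨q, hq⟩ := h
  obtain ⟨q', rfl⟩ := Polynomial.map_surjective mod2 (ZMod.ringHom_surjective mod2) q
  obtain ⟨r, hr⟩ := poly_two_dvd (p := p - f * q') (by
    rw [Polynomial.map_sub, Polynomial.map_mul, hq, sub_self])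
  refine ⟨AdjoinRoot.mk f r, ?_⟩
  have := congrArg (AdjoinRoot.mk f) hr
  rwa [map_sub, map_mul, map_mul, AdjoinRoot.mk_self, zero_mul, sub_zero,
    map_ofNat (AdjoinRoot.mk f) 2] at this

theorem toField_two {f : (ZMod 4)[X]} (x : GR f) : toField f (2 * x) = 0 := by
  have h : mod2 2 = 0 := by unfold mod2; decide
  have h2 : toField f 2 = 0 := by
    have := congrArg (AdjoinRoot.of (f.map mod2)) h
    rwa [map_ofNat mod2 2, map_ofNat (AdjoinRoot.of (f.map mod2)) 2, map_zero,
      ← map_ofNat (toField f) 2] at this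
  rw [map_mul, h2, zero_mul]

theorem two_mul_eq_zero {f : (ZMod 4)[X]} (hf : f.Monic) {x : GR f} (h : 2 * x = 0) :
    toField f x = 0 := by
  obtain ⟨p, rfl⟩ := AdjoinRoot.mk_surjective x
  have h' : AdjoinRoot.mk f (2 * p) = 0 := by
    rw [map_mul, map_ofNat (AdjoinRoot.mk f) 2]; exact h
  obtain ⟨q, hq⟩ := AdjoinRoot.mk_eq_zero.1 h'
  have h2 : (2 : (ZMod 2)[X]) = 0 := by
    have := congrArg (C : ZMod 2 → (ZMod 2)[X]) (show (2 : ZMod 2) = 0 by decide)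
    rwa [map_ofNat C 2, map_zero] at this
  have hm := congrArg (Polynomial.map mod2) hq
  rw [Polynomial.map_mul, Polynomial.map_mul, Polynomial.map_ofNat, h2, zero_mul] at hm
  have hq0 : q.map mod2 = 0 := by
    rcases mul_eq_zero.1 hm.symm with h0 | h0
    · exact absurd h0 (hf.map mod2).ne_zero
    · exact h0
  obtain ⟨r, rfl⟩ := poly_two_dvd hq0
  have h3 : (2 : (ZMod 4)[X]) * (p - f * r) = 0 := by linear_combination hq
  have h4 : (p - f * r).map mod2 = 0 := by
    ext i
    have := congrArg (fun g => Polynomial.coeff g i) h3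
    have hc : ∀ a : ZMod 4, 2 * a = 0 → mod2 a = 0 := by unfold mod2; decide
    rw [Polynomial.coeff_map, Polynomial.coeff_zero]
    apply hc
    have h5 : (2 : (ZMod 4)[X]) = C 2 := (map_ofNat C 2).symm
    simpa [h5, Polynomial.coeff_C_mul] using this
  rw [toField_mk, AdjoinRoot.mk_eq_zero]
  refine ⟨r.map mod2, ?_⟩
  rw [Polynomial.map_sub, Polynomial.map_mul] at h4
  exact sub_eq_zero.1 h4

theorem field_pow {f : (ZMod 4)[X]} (hf : IsBasicPrimitive f)
    (z : AdjoinRoot (f.map mod2)) : z ^ 2 ^ f.natDegree = z := by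
  have : Fact (Irreducible (f.map mod2)) := ⟨hf.2.1⟩
  have hne : f.map mod2 ≠ 0 := (hf.1.map mod2).ne_zero
  have : Module.Finite (ZMod 2) (AdjoinRoot (f.map mod2)) :=
    (AdjoinRoot.powerBasis hne).finite
  have : Finite (AdjoinRoot (f.map mod2)) := Module.finite_of_finite (ZMod 2)
  have := Fintype.ofFinite (AdjoinRoot (f.map mod2))
  have hcard : Fintype.card (AdjoinRoot (f.map mod2)) = 2 ^ f.natDegree := by
    rw [Module.card_eq_pow_finrank (K := ZMod 2), (AdjoinRoot.powerBasis hne).finrank,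
      AdjoinRoot.powerBasis_dim, hf.1.natDegree_map mod2, ZMod.card]
  rw [← hcard, FiniteField.pow_card]

theorem natDegree_pos {f : (ZMod 4)[X]} (hf : IsBasicPrimitive f) : 0 < f.natDegree := by
  rw [← hf.1.natDegree_map mod2]
  exact hf.2.1.natDegree_pos

theorem add_two_mul_pow {f : (ZMod 4)[X]} {n : ℕ} (hn : 0 < n) (x y : GR f) :
    (x + 2 * y) ^ 2 ^ n = x ^ 2 ^ n := by
  obtain ⟨k, rfl⟩ : ∃ k, n = k + 1 := ⟨n - 1, by omega⟩
  rw [pow_succ', pow_mul, pow_mul]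
  congr 1
  linear_combination (x * y + y ^ 2) * gr_four (f := f)

theorem digits_pow {f : (ZMod 4)[X]} {n : ℕ} {x : GR f} (h : x ∈ digits (GR f) n) :
    x ^ 2 ^ n = x := by
  rcases h with rfl | ⟨u, hu, rfl⟩
  · exact zero_pow (by positivity)
  · have h1 : u ^ (2 ^ n - 1) = 1 := (mem_rootsOfUnity _ _).1 hu
    have h2 : u ^ 2 ^ n = u := by
      rw [← Nat.sub_add_cancel (Nat.one_le_two_pow (n := n)), pow_succ, h1, one_mul]
    exact_mod_cast congrArg Units.val h2

theorem pow_mem_digits {f : (ZMod 4)[X]} (hf : IsBasicPrimitive f) (x : GR f) :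
    x ^ 2 ^ f.natDegree ∈ digits (GR f) f.natDegree := by
  have : Fact (Irreducible (f.map mod2)) := ⟨hf.2.1⟩
  have hn := natDegree_pos hf
  by_cases hx : toField f x = 0
  · left
    obtain ⟨y, rfl⟩ := toField_eq_zero hx
    have := add_two_mul_pow hn 0 y
    rw [zero_add, zero_pow (by positivity)] at this
    exact this
  · right
    set N := 2 ^ f.natDegree with hN
    have hN1 : 2 ≤ N := by
      rw [hN]; exact Nat.le_self_pow hn.ne' 2
    have h1 : toField f (x ^ (N - 1) - 1) = 0 := by
      rw [map_sub, map_pow, map_one, sub_eq_zero]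
      apply mul_right_cancel₀ hx
      rw [← pow_succ, Nat.sub_add_cancel (by omega), one_mul]
      exact field_pow hf _
    obtain ⟨z, hz⟩ := toField_eq_zero h1
    have h2 : (x ^ N) ^ (N - 1) = 1 := by
      rw [← pow_mul, mul_comm, pow_mul, show x ^ (N - 1) = 1 + 2 * z by
        linear_combination hz, hN, add_two_mul_pow hn, one_pow]
    have hk : N - 1 ≠ 0 := by omega
    exact ⟨Units.ofPowEqOne _ _ h2 hk, (mem_rootsOfUnity _ _).2 (Units.pow_ofPowEqOne h2 hk), rfl⟩

theorem existsUnique_isTwoAdic {f : (ZMod 4)[X]} (hf : IsBasicPrimitive f) (x : GR f) :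
    ∃! p : GR f × GR f, IsTwoAdic f.natDegree x p := by
  have hn := natDegree_pos hf
  have key : ∀ y : GR f, ∃ z, y = y ^ 2 ^ f.natDegree + 2 * z := fun y => by
    obtain ⟨z, hz⟩ := toField_eq_zero (x := y - y ^ 2 ^ f.natDegree) (by
      rw [map_sub, map_pow, field_pow hf, sub_self])
    exact ⟨z, by linear_combination hz⟩
  have inj : ∀ u ∈ digits (GR f) f.natDegree, ∀ v ∈ digits (GR f) f.natDegree,
      toField f u = toField f v → u = v := fun u hu v hv h => by
    obtain ⟨w, hw⟩ := toField_eq_zero (x := u - v) (by rw [map_sub, h, sub_self])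
    rw [← digits_pow hu, show u = v + 2 * w by linear_combination hw, add_two_mul_pow hn,
      digits_pow hv]
  obtain ⟨y, hy⟩ := key x
  obtain ⟨z, hz⟩ := key y
  refine ⟨(x ^ 2 ^ f.natDegree, y ^ 2 ^ f.natDegree),
    ⟨pow_mem_digits hf x, pow_mem_digits hf y, ?_⟩, ?_⟩
  · change x = x ^ 2 ^ f.natDegree + 2 * y ^ 2 ^ f.natDegree
    linear_combination hy + 2 * hz + z * gr_four (f := f)
  · rintro ⟨u, v⟩ ⟨hu, hv, huv⟩
    change x = u + 2 * v at huv
    have h1 : u = x ^ 2 ^ f.natDegree := by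
      rw [huv, add_two_mul_pow hn, digits_pow hu]
    have h2 : v = y ^ 2 ^ f.natDegree := by
      apply inj _ hv _ (pow_mem_digits hf y)
      rw [map_pow, field_pow hf, ← sub_eq_zero, ← map_sub]
      apply two_mul_eq_zero hf.1
      linear_combination hy - huv - h1
    rw [← h1, ← h2]

theorem isTwoAdic_twoAdic {f : (ZMod 4)[X]} (hf : IsBasicPrimitive f) (x : GR f) :
    IsTwoAdic f.natDegree x (twoAdic f.natDegree x) :=
  Classical.epsilon_spec (existsUnique_isTwoAdic hf x).exists

end QuadSeq

open QuadSeq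

namespace QuadSeq

/-! ### Digits, Frobenius and trace in the Galois ring. -/

section GaloisRing

variable {f : (ZMod 4)[X]}

/-! Expanding the traces writes `s` as a combination of geometric sequences whose ratios are `β ^ (2
^ a + 2 ^ b)` or `β ^ (2 ^ a)`. They are indexed by `(k, i)`: `k ≤ n / 2` is the cyclic distance
between the two binary digits, and `i` runs through one Frobenius orbit (`s_eq_sum`). The orbit has
`n` elements, except that it has `n / 2` when `2 * k = n`. The coefficient is the unit `1 + 2 * lam0
^ 2 ^ i` for `k = 0`. Otherwise it is twice a Frobenius power of `λ_k` (if `k ≤ ρ - 1`) plus `λ ^ (1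
+ 2 ^ k)` (if `e ∣ k`).

The ratios stay distinct modulo 2, so these sequences are linearly independent over the Galois ring,
zero divisors notwithstanding (`coeff_eq_zero_of_sum_eq_zero`). The linear span is therefore the
number of nonzero coefficients (`linearSpan_eq_card`). A characteristic polynomial must vanish
modulo 2 at each active ratio; conversely the active ratios are stable under squaring, so the
product of the `X - γ` descends to `ℤ₄`.

It remains to count. In characteristic 2 the orbit of `k` disappears exactly when `λ_k = 0` (for `k
∈ A`) or when `λ_k` reduces to `λ ^ (2 ^ k + 1)` (for `k ∈ B`). Since `ρ < n / 2`, these orbits all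
have full size `n` (`linearSpan_s_add`). Independence also recovers the parameters from the sequence
(`s_injective`), so counting sequences amounts to counting parameters (`card_finsupp_special`). -/

theorem two_mul_eq_two_mul_iff (hf : IsBasicPrimitive f) {x y : GR f} :
    2 * x = 2 * y ↔ toField f x = toField f y := by
  constructor
  · intro h
    rw [← sub_eq_zero, ← map_sub]
    exact two_mul_eq_zero hf.1 (by linear_combination h)
  · intro h
    obtain ⟨z, hz⟩ := toField_eq_zero (x := x - y) (by rw [map_sub, h, sub_self])
    linear_combination 2 * hz + z * gr_four (f := f)

theorem red_eq_red_iff {x y : GR f} :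
    red (GR f) x = red (GR f) y ↔ toField f x = toField f y := by
  rw [Ideal.Quotient.eq, Ideal.mem_span_singleton]
  constructor
  · rintro ⟨z, hz⟩
    rw [← sub_eq_zero, ← map_sub, hz, toField_two]
  · intro h
    obtain ⟨z, hz⟩ := toField_eq_zero (x := x - y) (by rw [map_sub, h, sub_self])
    exact ⟨z, hz⟩

theorem eq_of_mem_digits {n : ℕ} (hn : 0 < n) {u v : GR f} (hu : u ∈ digits (GR f) n)
    (hv : v ∈ digits (GR f) n) (h : toField f u = toField f v) : u = v := by
  obtain ⟨w, hw⟩ := toField_eq_zero (x := u - v) (by rw [map_sub, h, sub_self])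
  rw [← digits_pow hu, show u = v + 2 * w by linear_combination hw, add_two_mul_pow hn,
    digits_pow hv]

theorem mem_digits_iff (hf : IsBasicPrimitive f) {x : GR f} :
    x ∈ digits (GR f) f.natDegree ↔ x ^ 2 ^ f.natDegree = x :=
  ⟨digits_pow, fun h => h ▸ pow_mem_digits hf x⟩

theorem digits_mul (hf : IsBasicPrimitive f) {x y : GR f} (hx : x ∈ digits (GR f) f.natDegree)
    (hy : y ∈ digits (GR f) f.natDegree) : x * y ∈ digits (GR f) f.natDegree := by
  rw [mem_digits_iff hf] at *
  rw [mul_pow, hx, hy]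

theorem digits_pow_mem (hf : IsBasicPrimitive f) {x : GR f}
    (hx : x ∈ digits (GR f) f.natDegree) (k : ℕ) : x ^ k ∈ digits (GR f) f.natDegree := by
  rw [mem_digits_iff hf] at *
  rw [← pow_mul, mul_comm, pow_mul, hx]

theorem exists_digit (hf : IsBasicPrimitive f) (z : AdjoinRoot (f.map mod2)) :
    ∃ x ∈ digits (GR f) f.natDegree, toField f x = z := by
  obtain ⟨p, rfl⟩ := AdjoinRoot.mk_surjective z
  obtain ⟨q, rfl⟩ := Polynomial.map_surjective mod2 (ZMod.ringHom_surjective mod2) p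
  refine ⟨_, pow_mem_digits hf (AdjoinRoot.mk f q), ?_⟩
  rw [map_pow, field_pow hf, toField_mk]

theorem eq_zero_of_mul_eq_zero (hf : IsBasicPrimitive f) {x y : GR f} (hx : toField f x ≠ 0)
    (h : x * y = 0) : y = 0 := by
  have : Fact (Irreducible (f.map mod2)) := ⟨hf.2.1⟩
  have key : ∀ z, toField f (x * z) = 0 → ∃ w, z = 2 * w := fun z hz =>
    toField_eq_zero ((mul_eq_zero.1 ((map_mul (toField f) x z).symm.trans hz)).resolve_left hx)
  obtain ⟨w, rfl⟩ := key y (by rw [h, map_zero])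
  obtain ⟨v, rfl⟩ := key w (two_mul_eq_zero hf.1 (by linear_combination h))
  linear_combination v * gr_four (f := f)

theorem exists_eq_digit_add (hf : IsBasicPrimitive f) (x : GR f) :
    ∃ y ∈ digits (GR f) f.natDegree, ∃ z, x = y + 2 * z := by
  obtain ⟨p, ⟨h0, -, h⟩, -⟩ := existsUnique_isTwoAdic hf x
  exact ⟨_, h0, _, h⟩

/-- The second component matters only modulo 2, so `z` need not be a digit. This frees all later
computations from the chosen pair `twoAdic`. -/
theorem frob_digit_add (hf : IsBasicPrimitive f) {x : GR f}
    (hx : x ∈ digits (GR f) f.natDegree) (z : GR f) :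
    frob f.natDegree 1 (x + 2 * z) = x ^ 2 + 2 * z ^ 2 := by
  have hn := natDegree_pos hf
  obtain ⟨h0, -, h2⟩ := isTwoAdic_twoAdic hf (x + 2 * z)
  rw [frob]
  set p := twoAdic f.natDegree (x + 2 * z)
  have h3 : x = p.1 := by
    apply eq_of_mem_digits hn hx h0
    have := congrArg (toField f) h2
    rwa [map_add, map_add, toField_two, toField_two, add_zero, add_zero] at this
  have h4 : 2 * z ^ 2 = 2 * p.2 ^ 2 := by
    rw [two_mul_eq_two_mul_iff hf, map_pow, map_pow,
      (two_mul_eq_two_mul_iff hf).1 (show 2 * z = 2 * p.2 by linear_combination h2 - h3)]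
  rw [h4, ← h3, pow_one]

/-- At each squaring the old correction term dies modulo 4 and only the new cross term survives. For
digits and exponent `2 ^ n` this gives the leading digit of a sum. -/
theorem add_pow_two_pow_succ (x y : GR f) (k : ℕ) :
    (x + y) ^ 2 ^ (k + 1) = x ^ 2 ^ (k + 1) + y ^ 2 ^ (k + 1) + 2 * (x * y) ^ 2 ^ k := by
  induction k with
  | zero => ring
  | succ k ih =>
    have h2 : ∀ z : GR f, z ^ 2 ^ (k + 1 + 1) = (z ^ 2 ^ (k + 1)) ^ 2 := fun z => by
      rw [← pow_mul, ← pow_succ]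
    have h3 : (x * y) ^ 2 ^ (k + 1) = x ^ 2 ^ (k + 1) * y ^ 2 ^ (k + 1) := mul_pow _ _ _
    rw [h2, h2, h2, ih, h3]
    linear_combination ((x ^ 2 ^ (k + 1) + y ^ 2 ^ (k + 1)) * (x * y) ^ 2 ^ k +
      ((x * y) ^ 2 ^ k) ^ 2) * gr_four (f := f)

theorem frob_add_digits (hf : IsBasicPrimitive f) {x y : GR f}
    (hx : x ∈ digits (GR f) f.natDegree) (hy : y ∈ digits (GR f) f.natDegree) (z : GR f) :
    frob f.natDegree 1 (x + y + 2 * z) = x ^ 2 + y ^ 2 + 2 * z ^ 2 := by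
  obtain ⟨k, hk⟩ : ∃ k, f.natDegree = k + 1 := ⟨_, (Nat.sub_add_cancel (natDegree_pos hf)).symm⟩
  -- `w` is the square root of `x * y` among the digits, and the leading digit of `x + y` is `x + y
  -- + 2 * w`.
  set w := (x * y) ^ 2 ^ k
  have hw : w ^ 2 = x * y := by
    rw [← pow_mul, ← pow_succ, ← hk, digits_pow (digits_mul hf hx hy)]
  have h1 := add_pow_two_pow_succ x y k
  rw [← hk, digits_pow hx, digits_pow hy] at h1
  have h2 : x + y + 2 * z = (x + y) ^ 2 ^ f.natDegree + 2 * (z + w) := by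
    linear_combination -h1 - w * gr_four (f := f)
  have h3 : ((x + y) ^ 2 ^ f.natDegree) ^ 2 = x ^ 2 + y ^ 2 + 2 * (x * y) := by
    rw [h1]
    linear_combination (w * (x + y) + w ^ 2) * gr_four (f := f)
  rw [h2, frob_digit_add hf (pow_mem_digits hf _), h3]
  linear_combination 2 * hw + (x * y + z * w) * gr_four (f := f)

/-- The Frobenius automorphism over `ℤ₄`, as a ring homomorphism. -/
noncomputable def frobHom (hf : IsBasicPrimitive f) : GR f →+* GR f :=
  RingHom.mk'
    { toFun := frob f.natDegree 1
      map_one' := by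
        have := frob_digit_add hf (x := 1) ((mem_digits_iff hf).2 (one_pow _)) 0
        simpa using this
      map_mul' := fun x y => by
        obtain ⟨x, hx, u, rfl⟩ := exists_eq_digit_add hf x
        obtain ⟨y, hy, v, rfl⟩ := exists_eq_digit_add hf y
        rw [frob_digit_add hf hx, frob_digit_add hf hy,
          show (x + 2 * u) * (y + 2 * v) = x * y + 2 * (x * v + u * y) by
            linear_combination u * v * gr_four (f := f),
          frob_digit_add hf (digits_mul hf hx hy)]
        linear_combination (x * v * u * y - u ^ 2 * v ^ 2) * gr_four (f := f) }
    (fun x y => by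
      change frob _ _ _ = frob _ _ _ + frob _ _ _
      obtain ⟨x, hx, u, rfl⟩ := exists_eq_digit_add hf x
      obtain ⟨y, hy, v, rfl⟩ := exists_eq_digit_add hf y
      rw [frob_digit_add hf hx, frob_digit_add hf hy,
        show x + 2 * u + (y + 2 * v) = x + y + 2 * (u + v) by ring,
        frob_add_digits hf hx hy]
      linear_combination u * v * gr_four (f := f))

theorem frobHom_apply (hf : IsBasicPrimitive f) (x : GR f) :
    frobHom hf x = frob f.natDegree 1 x := rfl

theorem frobHom_digit (hf : IsBasicPrimitive f) {x : GR f}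
    (hx : x ∈ digits (GR f) f.natDegree) : frobHom hf x = x ^ 2 := by
  have := frob_digit_add hf hx 0
  simpa [frobHom_apply] using this

theorem frob_iterate_digit_add (hf : IsBasicPrimitive f) {x : GR f}
    (hx : x ∈ digits (GR f) f.natDegree) (z : GR f) (i : ℕ) :
    (frob f.natDegree 1)^[i] (x + 2 * z) = x ^ 2 ^ i + 2 * z ^ 2 ^ i := by
  induction i with
  | zero => simp
  | succ i ih =>
    rw [Function.iterate_succ_apply', ih, frob_digit_add hf (digits_pow_mem hf hx _),
      ← pow_mul, ← pow_mul, ← pow_succ]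

theorem frob_iterate_natDegree (hf : IsBasicPrimitive f) (x : GR f) :
    (frob f.natDegree 1)^[f.natDegree] x = x := by
  obtain ⟨x, hx, z, rfl⟩ := exists_eq_digit_add hf x
  rw [frob_iterate_digit_add hf hx, digits_pow hx, (two_mul_eq_two_mul_iff hf).2]
  rw [map_pow, field_pow hf]

theorem two_mul_frob_iterate (hf : IsBasicPrimitive f) (x : GR f) (i : ℕ) :
    2 * (frob f.natDegree 1)^[i] x = 2 * x ^ 2 ^ i := by
  obtain ⟨x, hx, z, rfl⟩ := exists_eq_digit_add hf x
  rw [frob_iterate_digit_add hf hx, two_mul_eq_two_mul_iff hf]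
  rw [map_add, map_pow, toField_two, map_pow, map_add, toField_two, add_zero, add_zero]

theorem two_mul_tr (hf : IsBasicPrimitive f) (k : ℕ) (x : GR f) :
    2 * tr f.natDegree k x = ∑ i ∈ Finset.range k, 2 * x ^ 2 ^ i := by
  rw [tr, Finset.mul_sum]
  exact Finset.sum_congr rfl fun i _ => two_mul_frob_iterate hf x i

theorem tr_digit_add (hf : IsBasicPrimitive f) {x : GR f}
    (hx : x ∈ digits (GR f) f.natDegree) (z : GR f) (k : ℕ) :
    tr f.natDegree k (x + 2 * z) = ∑ i ∈ Finset.range k, (x ^ 2 ^ i + 2 * z ^ 2 ^ i) :=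
  Finset.sum_congr rfl fun i _ => frob_iterate_digit_add hf hx z i

theorem frobHom_tr_add (hf : IsBasicPrimitive f) (k : ℕ) (x : GR f) :
    frobHom hf (tr f.natDegree k x) + x = tr f.natDegree k x + (frob f.natDegree 1)^[k] x := by
  rw [tr, map_sum, ← Finset.sum_range_succ, Finset.sum_range_succ']
  congr 1
  exact Finset.sum_congr rfl fun i _ => (Function.iterate_succ_apply' _ _ _).symm

theorem frobHom_tr (hf : IsBasicPrimitive f) (x : GR f) :
    frobHom hf (tr f.natDegree f.natDegree x) = tr f.natDegree f.natDegree x := by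
  have := frobHom_tr_add hf f.natDegree x
  rw [frob_iterate_natDegree hf] at this
  exact add_right_cancel this

/-- Modulo 2, `x ^ (2 ^ k + 1)` is the norm to the subfield of index 2, hence fixed by the `k`-th
Frobenius power, so the half-length sum telescopes. Doubling makes the residue the only thing that
matters. -/
theorem frobHom_two_mul_tr_half (hf : IsBasicPrimitive f) {k : ℕ} (hk : 2 * k = f.natDegree)
    (x : GR f) : frobHom hf (2 * tr f.natDegree k (x ^ (2 ^ k + 1))) =
      2 * tr f.natDegree k (x ^ (2 ^ k + 1)) := by
  have h := frobHom_tr_add hf k (x ^ (2 ^ k + 1))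
  have h1 := two_mul_frob_iterate hf (x ^ (2 ^ k + 1)) k
  have h2 : 2 * (x ^ (2 ^ k + 1)) ^ 2 ^ k = 2 * x ^ (2 ^ k + 1) := by
    rw [two_mul_eq_two_mul_iff hf, ← pow_mul,
      show (2 ^ k + 1) * 2 ^ k = 2 ^ f.natDegree + 2 ^ k by rw [← hk]; ring, pow_add, map_mul,
      map_pow _ x (2 ^ f.natDegree), field_pow hf, ← map_mul, pow_succ, mul_comm]
  rw [map_mul, map_ofNat]
  linear_combination 2 * h + h1 + h2

theorem algebraMap_injective (hf : IsBasicPrimitive f) :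
    Function.Injective (algebraMap (ZMod 4) (GR f)) := by
  have : Fact (Irreducible (f.map mod2)) := ⟨hf.2.1⟩
  have h2 : algebraMap (ZMod 4) (GR f) 2 ≠ 0 := by
    rw [map_ofNat]
    intro h
    have := two_mul_eq_zero hf.1 (x := (1 : GR f)) (by rw [h, zero_mul])
    rw [map_one] at this
    exact one_ne_zero this
  rw [injective_iff_map_eq_zero]
  intro a ha
  by_contra h
  have key : ∀ a : ZMod 4, a ≠ 0 → ∃ b, b * a = 2 := by decide
  obtain ⟨b, hb⟩ := key a h
  exact h2 (by rw [← hb, map_mul, ha, mul_zero])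

/-- For a fixed point `y + 2 * z`, the residues of `y` and `z` both satisfy `u ^ 2 = u` in a field.
Hence `y` is 0 or 1 and `2 * z` is 0 or 2. -/
theorem exists_algebraMap_eq (hf : IsBasicPrimitive f) {x : GR f} (hx : frobHom hf x = x) :
    ∃ a, algebraMap (ZMod 4) (GR f) a = x := by
  have : Fact (Irreducible (f.map mod2)) := ⟨hf.2.1⟩
  have hn := natDegree_pos hf
  have key : ∀ z : GR f, toField f z ^ 2 = toField f z → toField f z = 0 ∨ toField f z = 1 :=
    fun z hz => by
      have : toField f z * (toField f z - 1) = 0 := by linear_combination hz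
      exact (mul_eq_zero.1 this).imp_right sub_eq_zero.1
  obtain ⟨y, hy, z, rfl⟩ := exists_eq_digit_add hf x
  rw [frobHom_apply, frob_digit_add hf hy] at hx
  have h1 : ∃ a, algebraMap (ZMod 4) (GR f) a = y := by
    have h1 := congrArg (toField f) hx
    rw [map_add, map_add, toField_two, toField_two, add_zero, add_zero, map_pow] at h1
    rcases key y h1 with h | h
    · exact ⟨0, by rw [map_zero, eq_of_mem_digits hn hy (Or.inl rfl) (by rw [h, map_zero])]⟩
    · exact ⟨1, by rw [map_one, eq_of_mem_digits hn hy ((mem_digits_iff hf).2 (one_pow _))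
        (by rw [h, map_one])]⟩
  have h2 : y ^ 2 = y := by
    apply eq_of_mem_digits hn (digits_pow_mem hf hy _) hy
    have h1 := congrArg (toField f) hx
    rwa [map_add, map_add, toField_two, toField_two, add_zero, add_zero] at h1
  have h3 : ∃ a, algebraMap (ZMod 4) (GR f) a = 2 * z := by
    have h3 : toField f z ^ 2 = toField f z := by
      rw [← map_pow]
      exact (two_mul_eq_two_mul_iff hf).1 (by linear_combination hx - h2)
    rcases key z h3 with h | h
    · refine ⟨0, ?_⟩
      rw [map_zero, (two_mul_eq_two_mul_iff hf (y := 0)).2 (by rw [h, map_zero]), mul_zero]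
    · refine ⟨2, ?_⟩
      rw [map_ofNat, (two_mul_eq_two_mul_iff hf (y := 1)).2 (by rw [h, map_one]), mul_one]
  obtain ⟨a, ha⟩ := h1
  obtain ⟨b, hb⟩ := h3
  exact ⟨a + b, by rw [map_add, ha, hb]⟩

end GaloisRing

/-! ### Linear span of combinations of geometric sequences. -/

section LinearSpan

variable {f : (ZMod 4)[X]}

theorem sum_mul_eval_eq_zero {R ι : Type*} [CommRing R] {J : Finset ι} {γ c : ι → R}
    (h : ∀ t : ℕ, ∑ x ∈ J, c x * γ x ^ t = 0) (g : R[X]) :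
    ∑ x ∈ J, c x * g.eval (γ x) = 0 := by
  simp_rw [eval_eq_sum_range, Finset.mul_sum]
  rw [Finset.sum_comm]
  refine Finset.sum_eq_zero fun i _ => ?_
  have := congrArg (g.coeff i * ·) (h i)
  simp only [Finset.mul_sum, mul_zero] at this
  rw [← this]
  exact Finset.sum_congr rfl fun x _ => by ring

/-- Geometric sequences whose ratios are distinct modulo `2` are linearly independent. -/
theorem coeff_eq_zero_of_sum_eq_zero (hf : IsBasicPrimitive f) {ι : Type*} {J : Finset ι}
    {γ c : ι → GR f} (hγ : Set.InjOn (fun x => toField f (γ x)) J)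
    (h : ∀ t : ℕ, ∑ x ∈ J, c x * γ x ^ t = 0) {x : ι} (hx : x ∈ J) : c x = 0 := by
  classical
  have : Fact (Irreducible (f.map mod2)) := ⟨hf.2.1⟩
  -- This polynomial kills every term but the one at `x`, where its value is nonzero modulo 2 and
  -- hence not a zero divisor.
  have key := sum_mul_eval_eq_zero h (∏ y ∈ J.erase x, (X - C (γ y)))
  rw [Finset.sum_eq_single_of_mem x hx, eval_prod] at key
  · refine eq_zero_of_mul_eq_zero hf ?_ ((mul_comm _ _).trans key)
    rw [map_prod, Finset.prod_ne_zero_iff]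
    intro y hy
    rw [eval_sub, eval_X, eval_C, map_sub, sub_ne_zero]
    exact fun hxy => Finset.ne_of_mem_erase hy (hγ (Finset.mem_of_mem_erase hy) hx hxy.symm)
  · intro y hy hyx
    rw [eval_prod, Finset.prod_eq_zero (Finset.mem_erase.2 ⟨hyx, hy⟩) (by simp), mul_zero]

/-- Frobenius squares digits, and squaring is injective on them, so it permutes the finite set of
ratios. The product is thus Frobenius-invariant, and its coefficients lie in `ℤ₄`. -/
theorem exists_monic_map_eq_prod (hf : IsBasicPrimitive f) {ι : Type*} {J : Finset ι}
    {γ : ι → GR f} (hγ : Set.InjOn γ J) (hd : ∀ x ∈ J, γ x ∈ digits (GR f) f.natDegree)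
    (hsq : ∀ x ∈ J, ∃ y ∈ J, γ y = γ x ^ 2) :
    ∃ q : (ZMod 4)[X], q.Monic ∧ q.natDegree = J.card ∧
      q.map (algebraMap (ZMod 4) (GR f)) = ∏ x ∈ J, (X - C (γ x)) := by
  classical
  have : Fact (Irreducible (f.map mod2)) := ⟨hf.2.1⟩
  have : Nontrivial (GR f) := (toField f).domain_nontrivial
  have hn := natDegree_pos hf
  set G := J.image γ
  have hprod : ∏ x ∈ J, (X - C (γ x)) = ∏ u ∈ G, (X - C u) :=
    (Finset.prod_image (f := fun u => X - C u) hγ).symm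
  have hGd : ∀ u ∈ G, u ∈ digits (GR f) f.natDegree := fun u hu => by
    obtain ⟨x, hx, rfl⟩ := Finset.mem_image.1 hu
    exact hd x hx
  have hinj : Set.InjOn (fun u : GR f => u ^ 2) G := fun u hu v hv huv => by
    have huv : u ^ 2 = v ^ 2 := huv
    rw [← digits_pow (hGd u hu), ← digits_pow (hGd v hv), ← Nat.sub_add_cancel hn, pow_succ',
      pow_mul, pow_mul, huv]
  have himg : G.image (fun u => u ^ 2) = G := by
    apply Finset.eq_of_subset_of_card_le
    · intro u hu
      obtain ⟨v, hv, rfl⟩ := Finset.mem_image.1 hu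
      obtain ⟨x, hx, rfl⟩ := Finset.mem_image.1 hv
      obtain ⟨y, hy, hxy⟩ := hsq x hx
      exact Finset.mem_image.2 ⟨y, hy, hxy⟩
    · rw [Finset.card_image_of_injOn hinj]
  set p : (GR f)[X] := ∏ u ∈ G, (X - C u) with hp
  have hmap : p.map (frobHom hf) = p := by
    conv_rhs => rw [hp, ← himg, Finset.prod_image hinj]
    rw [hp, Polynomial.map_prod]
    refine Finset.prod_congr rfl fun u hu => ?_
    rw [Polynomial.map_sub, map_X, map_C, frobHom_digit hf (hGd u hu)]
  have hmonic : p.Monic := monic_prod_of_monic _ _ fun u _ => monic_X_sub_C u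
  have hl : p ∈ lifts (algebraMap (ZMod 4) (GR f)) := by
    rw [lifts_iff_coeff_lifts]
    intro i
    exact exists_algebraMap_eq hf (by rw [← coeff_map, hmap])
  obtain ⟨q, hq, hqd, hqm⟩ := lifts_and_natDegree_eq_and_monic hl hmonic
  refine ⟨q, hqm, ?_, hq.trans hprod.symm⟩
  rw [hqd, hp, natDegree_prod_of_monic _ _ fun u _ => monic_X_sub_C u]
  simp only [natDegree_X_sub_C, Finset.sum_const, smul_eq_mul, mul_one]
  exact Finset.card_image_of_injOn hγ

/-- The linear recurrence of order `q.natDegree` with characteristic polynomial `q`. -/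
def recurrenceOf {R : Type*} [CommRing R] (q : R[X]) : LinearRecurrence R where
  order := q.natDegree
  coeffs i := -q.coeff i

theorem isSolution_recurrenceOf {R : Type*} [CommRing R] {q : R[X]} (hq : q.Monic) {a : ℕ → R}
    (h : ∀ t, ∑ i ∈ Finset.range (q.natDegree + 1), q.coeff i * a (t + i) = 0) :
    (recurrenceOf q).IsSolution a := by
  intro t
  have h1 := h t
  rw [Finset.sum_range_succ, hq.coeff_natDegree, one_mul, ← Fin.sum_univ_eq_sum_range
    (fun i => q.coeff i * a (t + i))] at h1
  change a (t + q.natDegree) = ∑ i : Fin q.natDegree, -q.coeff i * a (t + i)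
  simp only [neg_mul, Finset.sum_neg_distrib]
  linear_combination h1

/-- The linear span of a combination of geometric sequences with ratios permuted by the
Frobenius automorphism is the number of ratios. -/
theorem linearSpan_eq_card (hf : IsBasicPrimitive f) {ι : Type*} {J : Finset ι}
    {γ c : ι → GR f} (hγ : Set.InjOn γ J) (hd : ∀ x ∈ J, γ x ∈ digits (GR f) f.natDegree)
    (hsq : ∀ x ∈ J, ∃ y ∈ J, γ y = γ x ^ 2) (hc : ∀ x ∈ J, c x ≠ 0) {a : ℕ → ZMod 4}
    (ha : Represents a fun t => ∑ x ∈ J, c x * γ x ^ t) : linearSpan a = J.card := by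
  classical
  have : Fact (Irreducible (f.map mod2)) := ⟨hf.2.1⟩
  have : Nontrivial (GR f) := (toField f).domain_nontrivial
  have : Nontrivial (ZMod 4) := ⟨0, 1, by decide⟩
  have hγ' : Set.InjOn (fun x => toField f (γ x)) J := fun x hx y hy hxy =>
    hγ hx hy (eq_of_mem_digits (natDegree_pos hf) (hd x hx) (hd y hy) hxy)
  refine IsLeast.csInf_eq ⟨?_, ?_⟩
  -- Upper bound: the descended product is the characteristic polynomial of a recurrence satisfied
  -- by `a`.
  · obtain ⟨q, hqm, hqd, hq⟩ := exists_monic_map_eq_prod hf hγ hd hsq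
    refine ⟨recurrenceOf q, hqd, isSolution_recurrenceOf hqm fun t => ?_⟩
    apply algebraMap_injective hf
    have ha' : ∀ t, algebraMap (ZMod 4) (GR f) (a t) = ∑ x ∈ J, c x * γ x ^ t := ha
    simp only [map_sum, map_mul, ha', map_zero, Finset.mul_sum]
    rw [Finset.sum_comm]
    refine Finset.sum_eq_zero fun x hx => ?_
    have h0 : (q.map (algebraMap (ZMod 4) (GR f))).eval (γ x) = 0 := by
      rw [hq, eval_prod, Finset.prod_eq_zero hx (by simp)]
    rw [eval_map, eval₂_eq_sum_range] at h0
    have := congrArg (c x * γ x ^ t * ·) h0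
    simp only [Finset.mul_sum, mul_zero] at this
    rw [← this]
    exact Finset.sum_congr rfl fun i _ => by ring
  · rintro L ⟨E, rfl, hE⟩
    set p := E.charPoly.map (algebraMap (ZMod 4) (GR f)) with hp
    have hpe : ∀ z, p.eval z = z ^ E.order -
        ∑ i : Fin E.order, algebraMap (ZMod 4) (GR f) (E.coeffs i) * z ^ (i : ℕ) := fun z => by
      simp [hp, LinearRecurrence.charPoly, Polynomial.eval_finsetSum, Polynomial.map_sum]
    -- Lower bound: independence gives `c x * p.eval (γ x) = 0`. As `c x` may be a zero divisor, one
    -- concludes only that `γ x` is a root modulo 2, which suffices to bound the degree over the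
    -- residue field.
    have h0 : ∀ t : ℕ, ∑ x ∈ J, (c x * p.eval (γ x)) * γ x ^ t = 0 := fun t => by
      have h1 := congrArg (algebraMap (ZMod 4) (GR f)) (hE t)
      rw [map_sum, ha] at h1
      have h2 : ∀ i, algebraMap (ZMod 4) (GR f) (a i) = ∑ x ∈ J, c x * γ x ^ i := ha
      simp only [map_mul, h2, Finset.mul_sum] at h1
      rw [Finset.sum_comm, ← sub_eq_zero, ← Finset.sum_sub_distrib] at h1
      rw [← h1]
      refine Finset.sum_congr rfl fun x _ => ?_
      rw [hpe, mul_sub, sub_mul, Finset.mul_sum, Finset.sum_mul]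
      congr 1
      · ring
      · exact Finset.sum_congr rfl fun i _ => by ring
    have h1 : ∀ x ∈ J, toField f (p.eval (γ x)) = 0 := fun x hx => by
      by_contra hne
      exact hc x hx (eq_zero_of_mul_eq_zero hf hne
        ((mul_comm _ _).trans (coeff_eq_zero_of_sum_eq_zero hf hγ' h0 hx)))
    have hmon : (p.map (toField f)).Monic := (E.charPoly_monic.map _).map _
    have hdeg : (p.map (toField f)).natDegree = E.order := by
      rw [(E.charPoly_monic.map _).natDegree_map, E.charPoly_monic.natDegree_map]
      exact natDegree_eq_of_degree_eq_some E.charPoly_degree_eq_order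
    rw [← hdeg, ← Finset.card_image_of_injOn hγ']
    apply card_le_degree_of_subset_roots
    intro z hz
    obtain ⟨x, hx, rfl⟩ := Finset.mem_image.1 (Finset.mem_def.2 hz)
    rw [mem_roots hmon.ne_zero, IsRoot, eval_map, eval₂_at_apply, h1 x hx]

end LinearSpan

/-! ### Exponents of binary weight at most two. -/

section Exponents

/-- The size of the orbit of `1 + 2 ^ k` under multiplication by `2` modulo `2 ^ n - 1`,
for `k ≤ n / 2`. -/
def orbitSize (n k : ℕ) : ℕ := if 2 * k = n then k else n

/-- The remainder of `2 ^ i * (1 + 2 ^ k)` modulo `2 ^ n - 1` for `0 < k`, and `2 ^ i` for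
`k = 0`. -/
def quadExp (n k i : ℕ) : ℕ := ∑ a ∈ {i, (i + k) % n}, 2 ^ a

/-- The indices `(k, i)` of the exponents of binary weight at most two. -/
def quadIndex (n : ℕ) : Finset (Σ _ : ℕ, ℕ) :=
  (Finset.range (n / 2 + 1)).sigma fun k => Finset.range (orbitSize n k)

theorem orbitSize_le (n k : ℕ) : orbitSize n k ≤ n := by
  unfold orbitSize; split <;> omega

theorem mem_quadIndex {n : ℕ} {x : Σ _ : ℕ, ℕ} :
    x ∈ quadIndex n ↔ x.1 ≤ n / 2 ∧ x.2 < orbitSize n x.1 := by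
  simp [quadIndex]

theorem quadExp_lt {n k i : ℕ} (hn : 3 ≤ n) (hi : i < n) : quadExp n k i < 2 ^ n - 1 := by
  have hsub : ({i, (i + k) % n} : Finset ℕ) ⊆ Finset.range n := by
    intro a ha
    simp only [Finset.mem_insert, Finset.mem_singleton] at ha
    rcases ha with rfl | rfl
    · exact Finset.mem_range.2 hi
    · exact Finset.mem_range.2 (Nat.mod_lt _ (by omega))
  -- `2 ^ n - 1` has all `n ≥ 3` binary digits equal to 1, whereas the exponent uses at most two of
  -- them.
  rw [← Nat.geomSum_eq le_rfl n |>.trans (Nat.div_one _)]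
  refine lt_of_le_of_ne (Finset.sum_le_sum_of_subset hsub) fun h => ?_
  have h1 := Finset.geomSum_injective le_rfl h
  have h2 := congrArg Finset.card h1
  have h3 : ({i, (i + k) % n} : Finset ℕ).card ≤ 2 := Finset.card_le_two
  rw [Finset.card_range] at h2
  omega

theorem mod_add_cases {n k i : ℕ} (hi : i < n) (hk : k ≤ n / 2) :
    (i + k < n ∧ (i + k) % n = i + k) ∨ (n ≤ i + k ∧ (i + k) % n = i + k - n) := by
  rcases lt_or_ge (i + k) n with h | h
  · exact Or.inl ⟨h, Nat.mod_eq_of_lt h⟩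
  · refine Or.inr ⟨h, ?_⟩
    rw [Nat.mod_eq_sub_mod h, Nat.mod_eq_of_lt (by omega)]

/-- Uniqueness of binary expansions reduces this to the sets `{i, (i + k) % n}`. The bound `k ≤ n /
2` makes `k` their cyclic distance; halving the range of `i` when `2 * k = n` removes the remaining
double count. -/
theorem quadExp_injOn (n : ℕ) :
    Set.InjOn (fun x : Σ _ : ℕ, ℕ => quadExp n x.1 x.2) (quadIndex n) := by
  rintro ⟨k, i⟩ hx ⟨k', i'⟩ hx' h
  obtain ⟨hk, hi⟩ := mem_quadIndex.1 (Finset.mem_coe.1 hx)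
  obtain ⟨hk', hi'⟩ := mem_quadIndex.1 (Finset.mem_coe.1 hx')
  dsimp only at hk hi hk' hi'
  have h1 : ({i, (i + k) % n} : Finset ℕ) = {i', (i' + k') % n} :=
    Finset.geomSum_injective le_rfl h
  have m1 : i ∈ ({i', (i' + k') % n} : Finset ℕ) := h1 ▸ by simp
  have m2 : (i + k) % n ∈ ({i', (i' + k') % n} : Finset ℕ) := h1 ▸ by simp
  have m3 : i' ∈ ({i, (i + k) % n} : Finset ℕ) := h1 ▸ by simp
  have m4 : (i' + k') % n ∈ ({i, (i + k) % n} : Finset ℕ) := h1 ▸ by simp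
  simp only [Finset.mem_insert, Finset.mem_singleton] at m1 m2 m3 m4
  have c1 := mod_add_cases (hi.trans_le (orbitSize_le n k)) hk
  have c2 := mod_add_cases (hi'.trans_le (orbitSize_le n k')) hk'
  generalize (i + k) % n = r at *
  generalize (i' + k') % n = r' at *
  unfold orbitSize at hi hi'
  have : k = k' ∧ i = i' := by split at hi <;> split at hi' <;> omega
  rw [this.1, this.2]

variable {f : (ZMod 4)[X]}

theorem pow_two_pow_mod {n : ℕ} {x : GR f} (hx : x ∈ digits (GR f) n) (a : ℕ) :
    x ^ 2 ^ (a % n) = x ^ 2 ^ a := by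
  have h : ∀ q : ℕ, x ^ 2 ^ (n * q) = x := fun q => by
    induction q with
    | zero => simp
    | succ q ih => rw [Nat.mul_succ, pow_add, pow_mul, ih, digits_pow hx]
  conv_rhs => rw [← Nat.div_add_mod a n, pow_add, pow_mul, h]

theorem pow_quadExp {n k i : ℕ} {x : GR f} (hx : x ∈ digits (GR f) n) (hk : 0 < k)
    (hkn : k ≤ n / 2) (hi : i < n) : x ^ quadExp n k i = (x ^ (1 + 2 ^ k)) ^ 2 ^ i := by
  have hne : i ≠ (i + k) % n := by
    have := mod_add_cases hi hkn
    omega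
  rw [quadExp, Finset.sum_pair hne, pow_add, pow_two_pow_mod hx, ← pow_mul, ← pow_add]
  congr 1
  ring

theorem quadExp_zero {n i : ℕ} (hi : i < n) : quadExp n 0 i = 2 ^ i := by
  simp [quadExp, Nat.mod_eq_of_lt hi]

/-- Squaring advances `i` by one and wraps around at the end of the orbit; for `2 * k = n` it does
so after `k` steps because `x ^ (1 + 2 ^ k)` is fixed by the power `2 ^ k`. -/
theorem exists_pow_quadExp_eq_sq {n : ℕ} (hn : 2 ≤ n) {x : GR f} (hx : x ∈ digits (GR f) n)
    {k i : ℕ} (hk : k ≤ n / 2) (hi : i < orbitSize n k) :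
    ∃ i' < orbitSize n k, x ^ quadExp n k i' = (x ^ quadExp n k i) ^ 2 := by
  have hle := orbitSize_le n k
  obtain ⟨y, hy, hyN⟩ : ∃ y : GR f, (∀ i < n, x ^ quadExp n k i = y ^ 2 ^ i) ∧
      y ^ 2 ^ orbitSize n k = y := by
    rcases Nat.eq_zero_or_pos k with rfl | hk0
    · refine ⟨x, fun i hi => by rw [quadExp_zero hi], ?_⟩
      rw [orbitSize, if_neg (by omega), digits_pow hx]
    · refine ⟨x ^ (1 + 2 ^ k), fun i hi => pow_quadExp hx hk0 hk hi, ?_⟩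
      unfold orbitSize
      split_ifs with h
      · rw [← pow_mul, show (1 + 2 ^ k) * 2 ^ k = 2 ^ k + 2 ^ n by rw [← h]; ring, pow_add,
          digits_pow hx, ← pow_succ, add_comm]
      · rw [← pow_mul, mul_comm, pow_mul, digits_pow hx]
  rcases Nat.lt_or_ge (i + 1) (orbitSize n k) with h | h
  · refine ⟨i + 1, h, ?_⟩
    rw [hy _ (by omega), hy _ (by omega), ← pow_mul, pow_succ]
  · refine ⟨0, by omega, ?_⟩
    rw [hy _ (by omega), hy _ (by omega), ← pow_mul, ← pow_succ,
      show i + 1 = orbitSize n k by omega, hyN, pow_zero, pow_one]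

theorem mem_digits_of_zpowers_eq {n : ℕ} {β : (GR f)ˣ}
    (hβ : Subgroup.zpowers β = groupC (GR f) n) : (β : GR f) ∈ digits (GR f) n :=
  Or.inr ⟨β, hβ ▸ Subgroup.mem_zpowers β, rfl⟩

/-- Primitivity of the reduced polynomial enters here: its root, of order `2 ^ n - 1`, lifts to a
digit that is a power of `β`, so its order divides that of the reduction of `β`. -/
theorem orderOf_toField_generator (hf : IsBasicPrimitive f) {β : (GR f)ˣ}
    (hβ : Subgroup.zpowers β = groupC (GR f) f.natDegree) :
    orderOf (toField f β) = 2 ^ f.natDegree - 1 := by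
  have : Fact (Irreducible (f.map mod2)) := ⟨hf.2.1⟩
  have hn := natDegree_pos hf
  have hmem : β ∈ groupC (GR f) f.natDegree := hβ ▸ Subgroup.mem_zpowers β
  apply Nat.dvd_antisymm
  · apply orderOf_dvd_of_pow_eq_one
    rw [← map_pow, ← Units.val_pow_eq_pow_val, (mem_rootsOfUnity _ _).1 hmem, Units.val_one,
      map_one]
  · have hroot := hf.2.2
    rw [hf.1.natDegree_map mod2] at hroot
    rw [← hroot]
    obtain ⟨x, hx, hxr⟩ := exists_digit hf (AdjoinRoot.root (f.map mod2))
    rcases hx with rfl | ⟨u, hu, rfl⟩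
    -- The root cannot be 0, since `orderOf 0` takes the default value 0.
    · rw [map_zero] at hxr
      have h2 : 2 ≤ 2 ^ f.natDegree := Nat.le_self_pow hn.ne' 2
      rw [← hxr, orderOf_eq_zero] at hroot
      · omega
      · rw [isOfFinOrder_iff_pow_eq_one]
        rintro ⟨k, hk, h⟩
        rw [zero_pow hk.ne'] at h
        exact zero_ne_one h
    · rw [← hβ] at hu
      obtain ⟨z, rfl⟩ := Subgroup.mem_zpowers_iff.1 hu
      have h1 : toField f ((β ^ z : (GR f)ˣ) : GR f) =
          ((Units.map (toField f).toMonoidHom β ^ z : (AdjoinRoot (f.map mod2))ˣ) :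
            AdjoinRoot (f.map mod2)) := by
        rw [← map_zpow]; rfl
      have h2 : toField f (β : GR f) = ((Units.map (toField f).toMonoidHom β :
          (AdjoinRoot (f.map mod2))ˣ) : AdjoinRoot (f.map mod2)) := rfl
      rw [← hxr, h1, h2, orderOf_units, orderOf_units]
      exact orderOf_dvd_of_mem_zpowers (Subgroup.zpow_mem_zpowers _ z)

theorem pow_quadExp_injOn (hf : IsBasicPrimitive f) (hn : 3 ≤ f.natDegree) {β : (GR f)ˣ}
    (hβ : Subgroup.zpowers β = groupC (GR f) f.natDegree) :
    Set.InjOn (fun x : Σ _ : ℕ, ℕ => toField f ((β : GR f) ^ quadExp f.natDegree x.1 x.2))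
      (quadIndex f.natDegree) := by
  intro x hx y hy h
  have hlt : ∀ z ∈ quadIndex f.natDegree,
      quadExp f.natDegree z.1 z.2 < orderOf (toField f β) := fun z hz => by
    rw [orderOf_toField_generator hf hβ]
    exact quadExp_lt hn ((mem_quadIndex.1 hz).2.trans_le (orbitSize_le _ _))
  apply quadExp_injOn _ hx hy
  apply pow_injOn_Iio_orderOf (x := toField f β) (hlt x hx) (hlt y hy)
  simpa using h

end Exponents

/-! ### Expansion of the sequences into geometric sequences. -/

section Expansion

theorem sum_range_succ_eq_add_sum_Icc {M : Type*} [AddCommMonoid M] (g : ℕ → M) (N : ℕ) :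
    ∑ k ∈ Finset.range (N + 1), g k = g 0 + ∑ k ∈ Finset.Icc 1 N, g k := by
  rw [Finset.range_eq_Ico, Finset.sum_eq_sum_Ico_succ_bot (Nat.succ_pos N)]
  rfl

theorem sum_filter_dvd_Icc {M : Type*} [AddCommMonoid M] {e : ℕ} (he : 0 < e) (N : ℕ)
    (g : ℕ → M) :
    ∑ k ∈ (Finset.Icc 1 N).filter (e ∣ ·), g k = ∑ j ∈ Finset.Icc 1 (N / e), g (e * j) := by
  symm
  refine Finset.sum_nbij (e * ·) ?_ ?_ ?_ fun _ _ => rfl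
  · intro j hj
    obtain ⟨h1, h2⟩ := Finset.mem_Icc.1 hj
    refine Finset.mem_filter.2 ⟨Finset.mem_Icc.2 ⟨Nat.mul_pos he h1, ?_⟩, dvd_mul_right _ _⟩
    rw [mul_comm]
    exact (Nat.le_div_iff_mul_le he).1 h2
  · exact fun a _ b _ h => Nat.eq_of_mul_eq_mul_left he h
  · intro k hk
    obtain ⟨hk, j, rfl⟩ := Finset.mem_filter.1 (Finset.mem_coe.1 hk)
    obtain ⟨h1, h2⟩ := Finset.mem_Icc.1 hk
    refine ⟨j, Finset.mem_coe.2 (Finset.mem_Icc.2 ⟨Nat.pos_of_mul_pos_left h1, ?_⟩), rfl⟩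
    rw [Nat.le_div_iff_mul_le he, mul_comm]
    exact h2

theorem mul_div_two_div {e m : ℕ} (he : 0 < e) : e * m / 2 / e = m / 2 := by
  rw [Nat.div_div_eq_div_mul, mul_comm 2 e, Nat.mul_div_mul_left _ _ he]

theorem sum_multiples_of_even {M : Type*} [AddCommMonoid M] {e m : ℕ} (he : 0 < e) (hm : 2 ≤ m)
    (g : ℕ → M) : ∑ k ∈ (Finset.Icc 1 (e * m / 2)).filter (e ∣ ·), g k =
      ∑ j ∈ Finset.Icc 1 (m / 2 - 1), g (e * j) + g (m / 2 * e) := by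
  rw [sum_filter_dvd_Icc he, mul_div_two_div he]
  conv_lhs => rw [show m / 2 = m / 2 - 1 + 1 by omega]
  rw [Finset.sum_Icc_succ_top (by omega), show m / 2 - 1 + 1 = m / 2 by omega, mul_comm e (m / 2)]

theorem sum_multiples {M : Type*} [AddCommMonoid M] {e m : ℕ} (he : 0 < e)
    (g : ℕ → M) : ∑ k ∈ (Finset.Icc 1 (e * m / 2)).filter (e ∣ ·), g k =
      ∑ j ∈ Finset.Icc 1 (m / 2), g (e * j) := by
  rw [sum_filter_dvd_Icc he, mul_div_two_div he]

theorem orbitSize_half {e m : ℕ} (h : Even m) : orbitSize (e * m) (m / 2 * e) = m / 2 * e := by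
  obtain ⟨r, rfl⟩ := h
  rw [orbitSize, if_pos]
  rw [show (r + r) / 2 = r by omega]
  ring

theorem orbitSize_of_lt {n k : ℕ} (h : 2 * k < n) : orbitSize n k = n := by
  rw [orbitSize, if_neg h.ne]

theorem two_mul_mul_lt_of_even {e m j : ℕ} (he : 0 < e) (hm : 2 ≤ m) (hj : j ≤ m / 2 - 1) :
    2 * (e * j) < e * m := by
  rw [mul_left_comm]
  exact Nat.mul_lt_mul_of_pos_left (by omega) he

theorem two_mul_mul_lt_of_odd {e m j : ℕ} (he : 0 < e) (h : ¬ Even m) (hj : j ≤ m / 2) :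
    2 * (e * j) < e * m := by
  rw [mul_left_comm]
  rw [Nat.even_iff] at h
  exact Nat.mul_lt_mul_of_pos_left (by omega) he

variable {f : (ZMod 4)[X]}

/-- Both parities of `m` give one formula, because `orbitSize` accounts for the half-length trace at
`k = n / 2`. -/
theorem two_mul_P {e m : ℕ} (hf : IsBasicPrimitive f) (hdeg : f.natDegree = e * m) (he : 0 < e)
    (hm : 2 ≤ m) (y : GR f) : 2 * P e m y = ∑ k ∈ (Finset.Icc 1 (e * m / 2)).filter (e ∣ ·),
      ∑ i ∈ Finset.range (orbitSize (e * m) k), 2 * (y ^ (1 + 2 ^ k)) ^ 2 ^ i := by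
  have htr := two_mul_tr hf
  rw [hdeg] at htr
  unfold P
  split_ifs with h
  · rw [sum_multiples_of_even he hm, orbitSize_half h, mul_add, Finset.mul_sum, htr, add_comm 1]
    congr 1
    refine Finset.sum_congr rfl fun j hj => ?_
    rw [htr, add_comm 1,
      orbitSize_of_lt (two_mul_mul_lt_of_even he hm (Finset.mem_Icc.1 hj).2)]
  · rw [sum_multiples he, Finset.mul_sum]
    refine Finset.sum_congr rfl fun j hj => ?_
    rw [htr, add_comm 1, orbitSize_of_lt (two_mul_mul_lt_of_odd he h (Finset.mem_Icc.1 hj).2)]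

/-- The coefficient, modulo `2`, of `x ^ (1 + 2 ^ k)` in the quadratic form defining `s`. -/
noncomputable def quadCoeff {R : Type*} [CommRing R] (e ρ : ℕ) (lam : R) (Lam : ℕ → R)
    (k : ℕ) : R :=
  (if k ≤ ρ - 1 then Lam k else 0) + if e ∣ k then lam ^ (1 + 2 ^ k) else 0

/-- The coefficient of `s` at the geometric sequence with ratio `β ^ quadExp n k i`. -/
noncomputable def expCoeff {R : Type*} [CommRing R] (e ρ : ℕ) (lam lam0 : R) (Lam : ℕ → R)
    (x : Σ _ : ℕ, ℕ) : R :=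
  if x.1 = 0 then 1 + 2 * lam0 ^ 2 ^ x.2 else 2 * quadCoeff e ρ lam Lam x.1 ^ 2 ^ x.2

theorem two_mul_add_pow (x y : GR f) (i : ℕ) :
    2 * (x + y) ^ 2 ^ i = 2 * x ^ 2 ^ i + 2 * y ^ 2 ^ i := by
  cases i with
  | zero => ring
  | succ i =>
    rw [add_pow_two_pow_succ]
    linear_combination (x * y) ^ 2 ^ i * gr_four (f := f)

/-- The sequence `s` is a combination of geometric sequences. -/
theorem s_eq_sum {e m ρ : ℕ} (hf : IsBasicPrimitive f) (hdeg : f.natDegree = e * m) (he : 2 ≤ e)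
    (hm : 2 ≤ m) (hρ : 1 ≤ ρ) (hρn : ρ < e * m / 2) {β lam lam0 : GR f} {Lam : ℕ → GR f}
    (hβ : β ∈ digits (GR f) (e * m)) (t : ℕ) :
    s e m ρ β lam lam0 Lam t = ∑ x ∈ quadIndex (e * m),
      expCoeff e ρ lam lam0 Lam x * (β ^ quadExp (e * m) x.1 x.2) ^ t := by
  have htr := two_mul_tr hf
  have htrd := fun x hx z k => tr_digit_add (f := f) (x := x) hf hx z k
  have hdp := fun x hx k => digits_pow_mem (f := f) (x := x) hf hx k
  rw [hdeg] at htr htrd hdp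
  set n := e * m with hn
  have hsplit : ∀ k ∈ Finset.Icc 1 (n / 2),
      ∑ i ∈ Finset.range (orbitSize n k), expCoeff e ρ lam lam0 Lam ⟨k, i⟩ *
        (β ^ quadExp n k i) ^ t =
      (if k ≤ ρ - 1 then ∑ i ∈ Finset.range n, 2 * (Lam k * β ^ (t * (1 + 2 ^ k))) ^ 2 ^ i else 0)
      + if e ∣ k then ∑ i ∈ Finset.range (orbitSize n k),
          2 * ((lam * β ^ t) ^ (1 + 2 ^ k)) ^ 2 ^ i else 0 := fun k hk => by
    obtain ⟨hk1, hk2⟩ := Finset.mem_Icc.1 hk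
    have hterm : ∀ i ∈ Finset.range (orbitSize n k),
        expCoeff e ρ lam lam0 Lam ⟨k, i⟩ * (β ^ quadExp n k i) ^ t =
        (if k ≤ ρ - 1 then 2 * (Lam k * β ^ (t * (1 + 2 ^ k))) ^ 2 ^ i else 0)
        + if e ∣ k then 2 * ((lam * β ^ t) ^ (1 + 2 ^ k)) ^ 2 ^ i else 0 := fun i hi => by
      have hi := (Finset.mem_range.1 hi).trans_le (orbitSize_le n k)
      have h0 : ((0 : GR f) ^ 2 ^ i) = 0 := zero_pow (by positivity)
      rw [expCoeff, if_neg (show k ≠ 0 by omega), pow_quadExp hβ hk1 hk2 hi, quadCoeff,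
        two_mul_add_pow, add_mul]
      congr 1
      · split_ifs
        · rw [mul_pow]; ring
        · rw [h0]; ring
      · split_ifs
        · rw [mul_pow, mul_pow]; ring
        · rw [h0]; ring
    rw [Finset.sum_congr rfl hterm, Finset.sum_add_distrib]
    congr 1
    · split_ifs with h
      -- Since `k ≤ ρ - 1 < n / 2`, the orbit is full and matches the full trace.
      · rw [orbitSize_of_lt (by omega)]
      · exact Finset.sum_const_zero
    · split_ifs with h
      · rfl
      · exact Finset.sum_const_zero
  rw [quadIndex, Finset.sum_sigma, sum_range_succ_eq_add_sum_Icc, Finset.sum_congr rfl hsplit,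
    Finset.sum_add_distrib, ← Finset.sum_filter, ← Finset.sum_filter,
    ← two_mul_P hf hdeg (by omega) hm, s, ← add_assoc]
  congr 1
  congr 1
  -- This trace is not doubled, so its argument has to be split into the digit `β ^ t` and a
  -- multiple of 2.
  · rw [show (1 + 2 * lam0) * β ^ t = β ^ t + 2 * (lam0 * β ^ t) by ring, htrd _ (hdp _ hβ _),
      orbitSize_of_lt (by omega)]
    refine Finset.sum_congr rfl fun i hi => ?_
    rw [expCoeff, if_pos rfl, quadExp_zero (Finset.mem_range.1 hi), mul_pow]
    ring
  · rw [show (Finset.Icc 1 (n / 2)).filter (· ≤ ρ - 1) = Finset.Icc 1 (ρ - 1) by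
      ext k; simp only [Finset.mem_filter, Finset.mem_Icc]; omega, Finset.mul_sum]
    exact Finset.sum_congr rfl fun k _ => htr _ _

theorem frobHom_two_mul_P {e m : ℕ} (hf : IsBasicPrimitive f) (hdeg : f.natDegree = e * m)
    (y : GR f) : frobHom hf (2 * P e m y) = 2 * P e m y := by
  have htr := frobHom_tr hf
  have hhalf := fun k (hk : 2 * k = f.natDegree) => frobHom_two_mul_tr_half hf hk
  rw [hdeg] at htr hhalf
  unfold P
  split_ifs with h
  · have hk : 2 * (m / 2 * e) = e * m := by
      rw [← mul_assoc, Nat.two_mul_div_two_of_even h, mul_comm]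
    rw [mul_add, map_add, hhalf _ hk, map_mul, map_ofNat, map_sum]
    simp_rw [htr]
  · rw [map_mul, map_ofNat, map_sum]
    simp_rw [htr]

theorem exists_represents_s {e m ρ : ℕ} (hf : IsBasicPrimitive f) (hdeg : f.natDegree = e * m)
    (β lam lam0 : GR f) (Lam : ℕ → GR f) :
    ∃ a : ℕ → ZMod 4, Represents a (s e m ρ β lam lam0 Lam) := by
  have htr := frobHom_tr hf
  rw [hdeg] at htr
  have h : ∀ t, ∃ a, algebraMap (ZMod 4) (GR f) a = s e m ρ β lam lam0 Lam t := fun t => by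
    apply exists_algebraMap_eq hf
    rw [s, map_add, map_add, frobHom_two_mul_P hf hdeg, htr, map_mul, map_ofNat, map_sum]
    simp_rw [htr]
  choose a ha using h
  exact ⟨a, ha⟩

theorem exists_represents_sExtra {e m : ℕ} (hf : IsBasicPrimitive f) (hdeg : f.natDegree = e * m)
    (β : GR f) : ∃ a : ℕ → ZMod 4, Represents a (sExtra e m β) := by
  have htr := frobHom_tr hf
  rw [hdeg] at htr
  have h : ∀ t, ∃ a, algebraMap (ZMod 4) (GR f) a = sExtra e m β t := fun t => by
    apply exists_algebraMap_eq hf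
    rw [sExtra, map_mul, map_ofNat, htr]
  choose a ha using h
  exact ⟨a, ha⟩

end Expansion

/-! ### Counting parameters and sequences. -/

section Counting

/-- Fibre over the coincidence sets `S ⊆ A`, `S' ⊆ B`: each index in `S ∪ S'` leaves one value, each
other index `T.card - 1`. Finitely supported functions keep the parameter space finite. -/
theorem card_finsupp_special {α : Type*} [Zero α] [DecidableEq α] {A B : Finset ℕ}
    (hAB : Disjoint A B) (T : Finset α) (v : ℕ → α) (hv : ∀ k, v k ∈ T) (j l : ℕ) :
    (((A ∪ B).finsupp fun _ => T).filter fun g =>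
      (A.filter fun k => g k = v k).card = j ∧ (B.filter fun k => g k = v k).card = l).card =
    A.card.choose j * B.card.choose l * (T.card - 1) ^ (A.card + B.card - j - l) := by
  rw [Finset.card_eq_sum_card_fiberwise
    (f := fun g => (A.filter fun k => g k = v k, B.filter fun k => g k = v k))
    (t := A.powersetCard j ×ˢ B.powersetCard l)]
  · rw [Finset.sum_const_nat (m := (T.card - 1) ^ (A.card + B.card - j - l)),
      Finset.card_product, Finset.card_powersetCard, Finset.card_powersetCard]
    rintro ⟨S, S'⟩ hS
    obtain ⟨hS, hS'⟩ := Finset.mem_product.1 hS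
    obtain ⟨hSA, hSj⟩ := Finset.mem_powersetCard.1 hS
    obtain ⟨hSB, hSl⟩ := Finset.mem_powersetCard.1 hS'
    dsimp only at hSA hSj hSB hSl
    have hfib : ((((A ∪ B).finsupp fun _ => T).filter fun g =>
        (A.filter fun k => g k = v k).card = j ∧
        (B.filter fun k => g k = v k).card = l).filter fun g =>
          (A.filter fun k => g k = v k, B.filter fun k => g k = v k) = (S, S')) =
        (A ∪ B).finsupp fun k => if k ∈ S ∪ S' then {v k} else T.erase (v k) := by
      ext g
      simp only [Finset.mem_filter, Finset.mem_finsupp_iff, Prod.mk.injEq]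
      constructor
      · rintro ⟨⟨⟨h1, h2⟩, -⟩, rfl, rfl⟩
        refine ⟨h1, fun k hk => ?_⟩
        split_ifs with h
        · simp only [Finset.mem_union, Finset.mem_filter] at h
          rw [Finset.mem_singleton]
          tauto
        · rw [Finset.mem_erase]
          simp only [Finset.mem_union, Finset.mem_filter] at h hk
          exact ⟨by tauto, h2 k (Finset.mem_union.2 hk)⟩
      · rintro ⟨h1, h2⟩
        have key : ∀ k ∈ A ∪ B, g k = v k ↔ k ∈ S ∪ S' := fun k hk => by
          have := h2 k hk
          split_ifs at this with h
          · exact iff_of_true (Finset.mem_singleton.1 this) h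
          · exact iff_of_false (Finset.mem_erase.1 this).1 h
        have hA : (A.filter fun k => g k = v k) = S := by
          ext k
          rw [Finset.mem_filter]
          constructor
          · rintro ⟨hk, hg⟩
            rcases Finset.mem_union.1 ((key k (Finset.mem_union_left _ hk)).1 hg) with h | h
            · exact h
            · exact absurd (hSB h) (Finset.disjoint_left.1 hAB hk)
          · intro hk
            exact ⟨hSA hk, (key k (Finset.mem_union_left _ (hSA hk))).2
              (Finset.mem_union_left _ hk)⟩
        have hB : (B.filter fun k => g k = v k) = S' := by
          ext k
          rw [Finset.mem_filter]
          constructor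
          · rintro ⟨hk, hg⟩
            rcases Finset.mem_union.1 ((key k (Finset.mem_union_right _ hk)).1 hg) with h | h
            · exact absurd hk (Finset.disjoint_left.1 hAB (hSA h))
            · exact h
          · intro hk
            exact ⟨hSB hk, (key k (Finset.mem_union_right _ (hSB hk))).2
              (Finset.mem_union_right _ hk)⟩
        refine ⟨⟨⟨h1, fun k hk => ?_⟩, by rw [hA, hSj], by rw [hB, hSl]⟩, hA, hB⟩
        have := h2 k hk
        split_ifs at this
        · rw [Finset.mem_singleton.1 this]
          exact hv k
        · exact Finset.mem_of_mem_erase this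
    have hc : ∀ k ∈ A ∪ B, (if k ∈ S ∪ S' then {v k} else T.erase (v k)).card =
        if k ∈ S ∪ S' then 1 else T.card - 1 := fun k _ => by
      split_ifs
      · exact Finset.card_singleton _
      · exact Finset.card_erase_of_mem (hv k)
    have hsub : S ∪ S' ⊆ A ∪ B := Finset.union_subset_union hSA hSB
    rw [hfib, Finset.card_finsupp, Finset.prod_congr rfl hc, Finset.prod_ite, Finset.prod_const_one,
      one_mul, Finset.prod_const, Finset.filter_notMem_eq_sdiff, Finset.card_sdiff_of_subset hsub,
      Finset.card_union_of_disjoint hAB,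
      Finset.card_union_of_disjoint (Finset.disjoint_of_subset_left hSA
        (Finset.disjoint_of_subset_right hSB hAB)), hSj, hSl, Nat.sub_sub]
  · intro g hg
    obtain ⟨-, hj, hl⟩ := Finset.mem_filter.1 (Finset.mem_coe.1 hg)
    exact Finset.mem_coe.2 (Finset.mem_product.2
      ⟨Finset.mem_powersetCard.2 ⟨Finset.filter_subset _ _, hj⟩,
        Finset.mem_powersetCard.2 ⟨Finset.filter_subset _ _, hl⟩⟩)

theorem disjoint_setA_setB (e ρ : ℕ) : Disjoint (setA e ρ) (setB e ρ) :=
  (Finset.disjoint_filter_filter_not _ _ _).symm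

theorem setA_union_setB (e ρ : ℕ) : setA e ρ ∪ setB e ρ = Finset.Icc 1 (ρ - 1) := by
  rw [Finset.union_comm]
  exact Finset.filter_union_filter_not_eq _ _

theorem card_setB {e : ℕ} (he : 0 < e) (ρ : ℕ) : (setB e ρ).card = (ρ - 1) / e := by
  rw [setB, Finset.card_eq_sum_ones, sum_filter_dvd_Icc he, ← Finset.card_eq_sum_ones,
    Nat.card_Icc, Nat.add_sub_cancel]

theorem card_setA_add_card_setB (e ρ : ℕ) : (setA e ρ).card + (setB e ρ).card = ρ - 1 := by
  rw [← Finset.card_union_of_disjoint (disjoint_setA_setB e ρ), setA_union_setB, Nat.card_Icc,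
    Nat.add_sub_cancel]

/-- There are `(m - 1) / 2` full orbits for odd `m`, and `m / 2 - 1` full ones plus a half orbit for
even `m`. Doubling avoids division in `ℕ`. -/
theorem two_mul_sum_orbitSize {e m : ℕ} (he : 0 < e) (hm : 2 ≤ m) :
    2 * ∑ k ∈ (Finset.Icc 1 (e * m / 2)).filter (e ∣ ·), orbitSize (e * m) k =
      e * m * (m - 1) := by
  by_cases h : Even m
  · rw [sum_multiples_of_even he hm, orbitSize_half h,
      Finset.sum_congr rfl fun j hj => orbitSize_of_lt
        (two_mul_mul_lt_of_even he hm (Finset.mem_Icc.1 hj).2), Finset.sum_const, Nat.card_Icc]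
    obtain ⟨r, rfl⟩ := h
    obtain ⟨r, rfl⟩ : ∃ q, r = q + 1 := ⟨r - 1, by omega⟩
    rw [show (r + 1 + (r + 1)) / 2 = r + 1 by omega, show r + 1 + (r + 1) - 1 = 2 * r + 1 by omega,
      Nat.add_sub_cancel, Nat.add_sub_cancel, smul_eq_mul]
    ring
  · rw [sum_multiples he, Finset.sum_congr rfl fun j hj => orbitSize_of_lt
        (two_mul_mul_lt_of_odd he h (Finset.mem_Icc.1 hj).2), Finset.sum_const, Nat.card_Icc]
    obtain ⟨r, rfl⟩ := Nat.not_even_iff_odd.1 h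
    rw [show (2 * r + 1) / 2 = r by omega, Nat.add_sub_cancel, Nat.add_sub_cancel, smul_eq_mul]
    ring

variable {f : (ZMod 4)[X]}

theorem ncard_digits (hf : IsBasicPrimitive f) :
    (digits (GR f) f.natDegree).ncard = 2 ^ f.natDegree := by
  have hne : f.map mod2 ≠ 0 := (hf.1.map mod2).ne_zero
  have : Module.Finite (ZMod 2) (AdjoinRoot (f.map mod2)) :=
    (AdjoinRoot.powerBasis hne).finite
  have hcard : Nat.card (AdjoinRoot (f.map mod2)) = 2 ^ f.natDegree := by
    have : Fact (Irreducible (f.map mod2)) := ⟨hf.2.1⟩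
    rw [Module.natCard_eq_pow_finrank (K := ZMod 2), (AdjoinRoot.powerBasis hne).finrank,
      AdjoinRoot.powerBasis_dim, hf.1.natDegree_map mod2, Nat.card_zmod]
  rw [← hcard, ← Nat.card_coe_set_eq]
  refine Nat.card_congr (Equiv.ofBijective (fun x => toField f x.1) ⟨?_, ?_⟩)
  · exact fun x y h => Subtype.ext (eq_of_mem_digits (natDegree_pos hf) x.2 y.2 h)
  · intro z
    obtain ⟨x, hx, rfl⟩ := exists_digit hf z
    exact ⟨⟨x, hx⟩, rfl⟩

theorem finite_digits (hf : IsBasicPrimitive f) : (digits (GR f) f.natDegree).Finite :=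
  Set.finite_of_ncard_ne_zero (by rw [ncard_digits hf]; positivity)

/-- The digits at which coefficients of `s` are counted as exceptional. -/
theorem exists_special_digit (hf : IsBasicPrimitive f) (e : ℕ) (lam : GR f) :
    ∃ v : ℕ → GR f, (∀ k, v k ∈ digits (GR f) f.natDegree) ∧ (∀ k, ¬ e ∣ k → v k = 0) ∧
      ∀ k, e ∣ k → toField f (v k) = toField f lam ^ (2 ^ k + 1) := by
  have h : ∀ k : ℕ, ∃ x ∈ digits (GR f) f.natDegree, (¬ e ∣ k → x = 0) ∧
      (e ∣ k → toField f x = toField f lam ^ (2 ^ k + 1)) := fun k => by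
    by_cases hk : e ∣ k
    · obtain ⟨x, hx, h⟩ := exists_digit hf (toField f lam ^ (2 ^ k + 1))
      exact ⟨x, hx, fun h' => absurd hk h', fun _ => h⟩
    · exact ⟨0, Or.inl rfl, fun _ => rfl, fun h' => absurd h' hk⟩
  choose v h1 h2 h3 using h
  exact ⟨v, h1, h2, h3⟩

theorem red_eq_red_pow_iff {x y : GR f} {i : ℕ} :
    red (GR f) x = red (GR f) y ^ i ↔ toField f x = toField f y ^ i := by
  rw [← map_pow, red_eq_red_iff, map_pow]

/-- Digits are determined by their residues, so both exceptional conditions take the common form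
`Lam k = v k` required for the count. -/
theorem hasType_iff {e m ρ : ℕ} (hf : IsBasicPrimitive f) (hdeg : f.natDegree = e * m)
    {lam : GR f} {v : ℕ → GR f} (hv : ∀ k, v k ∈ digits (GR f) f.natDegree)
    (hv0 : ∀ k, ¬ e ∣ k → v k = 0)
    (hv1 : ∀ k, e ∣ k → toField f (v k) = toField f lam ^ (2 ^ k + 1)) [DecidableEq (GR f)]
    {j l : ℕ} {lam0 : GR f} {Lam : ℕ → GR f} :
    HasType e m ρ lam j l lam0 Lam ↔ lam0 ∈ digits (GR f) f.natDegree ∧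
      (∀ k ∈ Finset.Icc 1 (ρ - 1), Lam k ∈ digits (GR f) f.natDegree) ∧
      ((setA e ρ).filter fun k => Lam k = v k).card = j ∧
      ((setB e ρ).filter fun k => Lam k = v k).card = l := by
  unfold HasType
  rw [← hdeg]
  refine and_congr_right fun _ => and_congr_right fun hL => ?_
  have hA : ∀ k ∈ setA e ρ, Lam k = 0 ↔ Lam k = v k := fun k hk => by
    rw [hv0 k (Finset.mem_filter.1 hk).2]
  have hB : ∀ k ∈ setB e ρ, red (GR f) (Lam k) = red (GR f) lam ^ (2 ^ k + 1) ↔ Lam k = v k :=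
    fun k hk => by
      obtain ⟨hk, hek⟩ := Finset.mem_filter.1 hk
      rw [red_eq_red_pow_iff, ← hv1 k hek]
      exact ⟨eq_of_mem_digits (natDegree_pos hf) (hL k hk) (hv k), fun h => by rw [h]⟩
  refine and_congr (iff_of_eq (congrArg (· = j) (congrArg Finset.card ?_)))
    (iff_of_eq (congrArg (· = l) (congrArg Finset.card ?_)))
  · ext k
    simp only [Finset.mem_filter]
    exact and_congr_right (hA k)
  · ext k
    simp only [Finset.mem_filter]
    exact and_congr_right (hB k)

theorem s_congr {R : Type*} [CommRing R] {e m ρ : ℕ} {β lam lam0 : R} {Lam Lam' : ℕ → R}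
    (h : ∀ k ∈ Finset.Icc 1 (ρ - 1), Lam k = Lam' k) :
    s e m ρ β lam lam0 Lam = s e m ρ β lam lam0 Lam' := by
  funext t
  rw [s, s, Finset.sum_congr rfl fun k hk => by rw [h k hk]]

theorem s_injective {e m ρ : ℕ} (hf : IsBasicPrimitive f) (hdeg : f.natDegree = e * m)
    (he : 2 ≤ e) (hm : 2 ≤ m) (hρ : 1 ≤ ρ) (hρn : ρ < e * m / 2) {β : (GR f)ˣ}
    (hβ : Subgroup.zpowers β = groupC (GR f) (e * m)) {lam lam0 lam0' : GR f}
    {Lam Lam' : ℕ → GR f} (h0 : lam0 ∈ digits (GR f) f.natDegree)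
    (h0' : lam0' ∈ digits (GR f) f.natDegree)
    (hL : ∀ k ∈ Finset.Icc 1 (ρ - 1), Lam k ∈ digits (GR f) f.natDegree)
    (hL' : ∀ k ∈ Finset.Icc 1 (ρ - 1), Lam' k ∈ digits (GR f) f.natDegree)
    (h : s e m ρ (β : GR f) lam lam0 Lam = s e m ρ (β : GR f) lam lam0' Lam') :
    lam0 = lam0' ∧ ∀ k ∈ Finset.Icc 1 (ρ - 1), Lam k = Lam' k := by
  have hn := natDegree_pos hf
  have hinj := pow_quadExp_injOn hf (by omega) (hdeg ▸ hβ)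
  rw [hdeg] at hinj
  have hsum : ∀ t : ℕ, ∑ x ∈ quadIndex (e * m), (expCoeff e ρ lam lam0 Lam x -
      expCoeff e ρ lam lam0' Lam' x) * ((β : GR f) ^ quadExp (e * m) x.1 x.2) ^ t = 0 := fun t => by
    simp_rw [sub_mul]
    rw [Finset.sum_sub_distrib,
      ← s_eq_sum hf hdeg he hm hρ hρn (mem_digits_of_zpowers_eq hβ),
      ← s_eq_sum hf hdeg he hm hρ hρn (mem_digits_of_zpowers_eq hβ), h, sub_self]
  -- The entry `i = 0` of each orbit carries the parameter without a Frobenius power, so it alone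
  -- recovers `lam0` and `Lam k`.
  have key : ∀ k < e * m / 2, expCoeff e ρ lam lam0 Lam ⟨k, 0⟩ =
      expCoeff e ρ lam lam0' Lam' ⟨k, 0⟩ := fun k hk =>
    sub_eq_zero.1 (coeff_eq_zero_of_sum_eq_zero hf hinj hsum (mem_quadIndex.2
      ⟨hk.le, by rw [orbitSize_of_lt (by dsimp only; omega)]; dsimp only; omega⟩))
  constructor
  · have := key 0 (by omega)
    simp only [expCoeff, if_pos, pow_zero, pow_one] at this
    exact eq_of_mem_digits hn h0 h0' ((two_mul_eq_two_mul_iff hf).1 (add_left_cancel this))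
  · intro k hk
    obtain ⟨h1, h2⟩ := Finset.mem_Icc.1 hk
    have := key k (by omega)
    simp only [expCoeff, if_neg (show k ≠ 0 by omega), pow_zero, pow_one, quadCoeff,
      if_pos h2] at this
    apply eq_of_mem_digits hn (hL k hk) (hL' k hk) ((two_mul_eq_two_mul_iff hf).1 _)
    linear_combination this

theorem Represents.unique (hf : IsBasicPrimitive f) {a a' : ℕ → ZMod 4} {b : ℕ → GR f}
    (h : Represents a b) (h' : Represents a' b) : a = a' :=
  funext fun t => algebraMap_injective hf ((h t).trans (h' t).symm)

/-- The number of sequences of a given type. -/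
theorem ncard_sequences {e m ρ : ℕ} (hf : IsBasicPrimitive f) (hdeg : f.natDegree = e * m)
    (he : 2 ≤ e) (hm : 2 ≤ m) (hρ : 1 ≤ ρ) (hρn : ρ < e * m / 2) {β : (GR f)ˣ}
    (hβ : Subgroup.zpowers β = groupC (GR f) (e * m)) (lam : GR f) (j l : ℕ) :
    {a : ℕ → ZMod 4 | ∃ (lam0 : GR f) (Lam : ℕ → GR f), HasType e m ρ lam j l lam0 Lam ∧
      Represents a (s e m ρ (β : GR f) lam lam0 Lam)}.ncard =
    (setA e ρ).card.choose j * (setB e ρ).card.choose l * 2 ^ (e * m) *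
      (2 ^ (e * m) - 1) ^ ((setA e ρ).card + (setB e ρ).card - j - l) := by
  classical
  obtain ⟨v, hv, hv0, hv1⟩ := exists_special_digit hf e lam
  have hty := fun lam0 Lam => hasType_iff (ρ := ρ) (j := j) (l := l) (lam0 := lam0) (Lam := Lam)
    hf hdeg hv hv0 hv1
  set T := (finite_digits hf).toFinset with hT
  have hmemT : ∀ x, x ∈ T ↔ x ∈ digits (GR f) f.natDegree := fun x => Set.Finite.mem_toFinset _
  have hTcard : T.card = 2 ^ (e * m) := by
    rw [← hdeg, ← ncard_digits hf, Set.ncard_eq_toFinset_card _ (finite_digits hf)]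
  -- Values of `Lam` outside `1, …, ρ - 1` do not affect `s`; normalising them to 0 makes the
  -- parametrisation by `W` injective.
  set W := T ×ˢ (((setA e ρ ∪ setB e ρ).finsupp fun _ => T).filter fun g =>
      ((setA e ρ).filter fun k => g k = v k).card = j ∧
      ((setB e ρ).filter fun k => g k = v k).card = l) with hW
  have hmemW : ∀ p ∈ W, HasType e m ρ lam j l p.1 p.2 := fun p hp => by
    obtain ⟨h1, h2⟩ := Finset.mem_product.1 hp
    obtain ⟨h2, h3⟩ := Finset.mem_filter.1 h2
    rw [Finset.mem_finsupp_iff, setA_union_setB] at h2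
    exact (hty _ _).2 ⟨(hmemT _).1 h1, fun k hk => (hmemT _).1 (h2.2 k hk), h3⟩
  choose F hF using fun p : GR f × (ℕ →₀ GR f) =>
    exists_represents_s (ρ := ρ) hf hdeg (β : GR f) lam p.1 p.2
  have himage : {a : ℕ → ZMod 4 | ∃ (lam0 : GR f) (Lam : ℕ → GR f),
      HasType e m ρ lam j l lam0 Lam ∧ Represents a (s e m ρ (β : GR f) lam lam0 Lam)} =
      F '' W := by
    ext a
    constructor
    · rintro ⟨lam0, Lam, ht, ha⟩
      obtain ⟨h1, h2, h3, h4⟩ := (hty _ _).1 ht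
      set g : ℕ →₀ GR f := Finsupp.indicator (Finset.Icc 1 (ρ - 1)) fun k _ => Lam k
      have hg : ∀ k ∈ Finset.Icc 1 (ρ - 1), g k = Lam k := fun k hk =>
        Finsupp.indicator_of_mem hk _
      have hA : ∀ k ∈ setA e ρ, Lam k = v k ↔ g k = v k := fun k hk => by
        rw [hg k (Finset.mem_filter.1 hk).1]
      have hB : ∀ k ∈ setB e ρ, Lam k = v k ↔ g k = v k := fun k hk => by
        rw [hg k (Finset.mem_filter.1 hk).1]
      refine ⟨(lam0, g), Finset.mem_coe.2 (Finset.mem_product.2 ⟨(hmemT _).2 h1,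
        Finset.mem_filter.2 ⟨?_, ?_, ?_⟩⟩), ?_⟩
      · rw [Finset.mem_finsupp_iff, setA_union_setB]
        exact ⟨Finsupp.support_indicator_subset _ _,
          fun k hk => by rw [hg k hk]; exact (hmemT _).2 (h2 k hk)⟩
      · rw [← Finset.filter_congr hA, h3]
      · rw [← Finset.filter_congr hB, h4]
      · refine Represents.unique hf (hF _) ?_
        rwa [s_congr hg]
    · rintro ⟨p, hp, rfl⟩
      exact ⟨p.1, p.2, hmemW p hp, hF p⟩
  have hinj : Set.InjOn F W := by
    rintro ⟨lam0, g⟩ hp ⟨lam0', g'⟩ hp' hpp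
    obtain ⟨h1, h2, -⟩ := (hty _ _).1 (hmemW _ hp)
    obtain ⟨h1', h2', -⟩ := (hty _ _).1 (hmemW _ hp')
    have hs : s e m ρ (β : GR f) lam lam0 g = s e m ρ (β : GR f) lam lam0' g' := funext fun t => by
      have := hF (lam0, g) t
      rw [hpp] at this
      exact this.symm.trans (hF (lam0', g') t)
    obtain ⟨h3, h4⟩ := s_injective hf hdeg he hm hρ hρn hβ h1 h1' h2 h2' hs
    have hsupp : ∀ p ∈ W, ∀ k ∉ Finset.Icc 1 (ρ - 1), p.2 k = 0 := fun p hp k hk => by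
      have := (Finset.mem_finsupp_iff.1 (Finset.mem_filter.1 (Finset.mem_product.1 hp).2).1).1
      rw [setA_union_setB] at this
      exact Finsupp.notMem_support_iff.1 fun h => hk (this h)
    refine Prod.ext h3 (Finsupp.ext fun k => ?_)
    by_cases hk : k ∈ Finset.Icc 1 (ρ - 1)
    · exact h4 k hk
    · exact (hsupp _ hp k hk).trans (hsupp _ hp' k hk).symm
  rw [himage, hinj.ncard_image, Set.ncard_coe_finset, hW, Finset.card_product,
    card_finsupp_special (disjoint_setA_setB e ρ) T v fun k => (hmemT _).2 (hv k), hTcard]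
  ring

end Counting

/-! ### Linear spans of the members of the family. -/

section Span

variable {f : (ZMod 4)[X]}

/-- The criterion does not involve `x.2`, so the set of active ratios is a union of whole Frobenius
orbits, hence stable under squaring. -/
theorem expCoeff_ne_zero_iff (hf : IsBasicPrimitive f) {e ρ : ℕ} {lam lam0 : GR f}
    {Lam : ℕ → GR f} {x : Σ _ : ℕ, ℕ} : expCoeff e ρ lam lam0 Lam x ≠ 0 ↔
      x.1 = 0 ∨ toField f (quadCoeff e ρ lam Lam x.1) ≠ 0 := by
  have : Fact (Irreducible (f.map mod2)) := ⟨hf.2.1⟩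
  rw [expCoeff]
  split_ifs with h
  · refine iff_of_true (fun h0 => ?_) (Or.inl h)
    have := congrArg (toField f) h0
    rw [map_add, toField_two, map_one, map_zero, add_zero] at this
    exact one_ne_zero this
  · have h2 : (2 * quadCoeff e ρ lam Lam x.1 ^ 2 ^ x.2 = 0) ↔
        toField f (quadCoeff e ρ lam Lam x.1) = 0 := by
      have := two_mul_eq_two_mul_iff hf (x := quadCoeff e ρ lam Lam x.1 ^ 2 ^ x.2) (y := 0)
      rw [mul_zero, map_zero, map_pow] at this
      rw [this]
      exact pow_eq_zero_iff (by positivity)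
    rw [ne_eq, h2]
    simp [h]

theorem card_filter_quadIndex (n : ℕ) (Q : ℕ → Prop) [DecidablePred Q] :
    ((quadIndex n).filter fun x => Q x.1).card =
      ∑ k ∈ Finset.range (n / 2 + 1), if Q k then orbitSize n k else 0 := by
  rw [Finset.card_filter, quadIndex, Finset.sum_sigma]
  refine Finset.sum_congr rfl fun k _ => ?_
  dsimp only
  split_ifs <;> simp

theorem linearSpan_s_eq_card {e m ρ : ℕ} (hf : IsBasicPrimitive f) (hdeg : f.natDegree = e * m)
    (he : 2 ≤ e) (hm : 2 ≤ m) (hρ : 1 ≤ ρ) (hρn : ρ < e * m / 2) {β : (GR f)ˣ}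
    (hβ : Subgroup.zpowers β = groupC (GR f) (e * m)) {lam lam0 : GR f} {Lam : ℕ → GR f}
    {a : ℕ → ZMod 4} (ha : Represents a (s e m ρ (β : GR f) lam lam0 Lam))
    [DecidablePred fun k => k = 0 ∨ toField f (quadCoeff e ρ lam Lam k) ≠ 0] :
    linearSpan a = ((quadIndex (e * m)).filter fun x =>
      x.1 = 0 ∨ toField f (quadCoeff e ρ lam Lam x.1) ≠ 0).card := by
  have hβd := mem_digits_of_zpowers_eq hβ
  have hinj := pow_quadExp_injOn hf (by omega) (hdeg ▸ hβ)
  have hdp := fun x hx k => digits_pow_mem (f := f) (x := x) hf hx k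
  have hspan := @linearSpan_eq_card f hf (Σ _ : ℕ, ℕ)
  rw [hdeg] at hinj hdp hspan
  refine hspan (γ := fun x => (β : GR f) ^ quadExp (e * m) x.1 x.2)
    (c := expCoeff e ρ lam lam0 Lam) ?_ ?_ ?_ ?_ ?_
  · exact fun x hx y hy h => hinj (Finset.filter_subset _ _ hx) (Finset.filter_subset _ _ hy)
      (congrArg (toField f) h)
  · exact fun x _ => hdp _ hβd _
  · rintro ⟨k, i⟩ hx
    obtain ⟨hx, hQ⟩ := Finset.mem_filter.1 hx
    obtain ⟨hk, hi⟩ := mem_quadIndex.1 hx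
    obtain ⟨i', hi', h⟩ := exists_pow_quadExp_eq_sq (by omega) hβd hk hi
    exact ⟨⟨k, i'⟩, Finset.mem_filter.2 ⟨mem_quadIndex.2 ⟨hk, hi'⟩, hQ⟩, h⟩
  · exact fun x hx => (expCoeff_ne_zero_iff hf).2 (Finset.mem_filter.1 hx).2
  · intro t
    rw [ha t, s_eq_sum hf hdeg he hm hρ hρn hβd]
    symm
    apply Finset.sum_filter_of_ne
    intro x _ hne
    exact (expCoeff_ne_zero_iff hf).1 (left_ne_zero_of_mul hne)

/-- The vanished orbits are added back on the left, which avoids truncated subtraction. -/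
theorem linearSpan_s_add {e m ρ : ℕ} (hf : IsBasicPrimitive f) (hdeg : f.natDegree = e * m)
    (he : 2 ≤ e) (hm : 2 ≤ m) (hρ : 1 ≤ ρ) (hρn : ρ < e * m / 2) {β : (GR f)ˣ}
    (hβ : Subgroup.zpowers β = groupC (GR f) (e * m)) {lam lam0 : GR f} {Lam : ℕ → GR f}
    (hlam : toField f lam ≠ 0) {j l : ℕ} (ht : HasType e m ρ lam j l lam0 Lam)
    {a : ℕ → ZMod 4} (ha : Represents a (s e m ρ (β : GR f) lam lam0 Lam)) :
    linearSpan a + e * m * j + e * m * l = e * m + e * m * (setA e ρ).card +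
      ∑ k ∈ (Finset.Icc 1 (e * m / 2)).filter (e ∣ ·), orbitSize (e * m) k := by
  classical
  have : Fact (Irreducible (f.map mod2)) := ⟨hf.2.1⟩
  have hn := natDegree_pos hf
  obtain ⟨v, hv, hv0, hv1⟩ := exists_special_digit hf e lam
  obtain ⟨-, hL, hj, hl⟩ := (hasType_iff hf hdeg hv hv0 hv1).1 ht
  have hchar : ∀ z : AdjoinRoot (f.map mod2), z + z = 0 := fun z => by
    obtain ⟨x, -, rfl⟩ := exists_digit hf z
    rw [← map_add, ← two_mul, toField_two]
  set n := e * m with hndef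
  -- The balance for a single `k`: its orbit is either active or one of the `j + l` exceptional
  -- ones, each of size `n`, or has no term at all. For `k ≥ ρ` with `e ∣ k` it is always active,
  -- since `λ` is nonzero modulo 2.
  have hQ : ∀ k ∈ Finset.Icc 1 (n / 2),
      ((if k = 0 ∨ toField f (quadCoeff e ρ lam Lam k) ≠ 0 then orbitSize n k else 0) +
        if (k ≤ ρ - 1 ∧ ¬ e ∣ k) ∧ Lam k = v k then n else 0) +
        (if (k ≤ ρ - 1 ∧ e ∣ k) ∧ Lam k = v k then n else 0) =
      (if k ≤ ρ - 1 ∧ ¬ e ∣ k then n else 0) + if e ∣ k then orbitSize n k else 0 := fun k hk => by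
    obtain ⟨hk1, hk2⟩ := Finset.mem_Icc.1 hk
    have hk0 : k ≠ 0 := by omega
    have hlk : toField f lam ^ (1 + 2 ^ k) ≠ 0 := pow_ne_zero _ hlam
    by_cases hkρ : k ≤ ρ - 1 <;> by_cases hek : e ∣ k
    · have horb : orbitSize n k = n := orbitSize_of_lt (by omega)
      have hiff : toField f (quadCoeff e ρ lam Lam k) = 0 ↔ Lam k = v k := by
        rw [quadCoeff, if_pos hkρ, if_pos hek, map_add, map_pow, add_comm 1, ← hv1 k hek]
        constructor
        · intro h
          refine eq_of_mem_digits hn (hL k (Finset.mem_Icc.2 ⟨hk1, hkρ⟩)) (hv k) ?_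
          linear_combination h - hchar (toField f (v k))
        · intro h
          rw [h, hchar]
      by_cases hz : Lam k = v k <;> simp [hk0, hkρ, hek, hiff, hz, horb]
    · have horb : orbitSize n k = n := orbitSize_of_lt (by omega)
      have hiff : toField f (quadCoeff e ρ lam Lam k) = 0 ↔ Lam k = v k := by
        rw [quadCoeff, if_pos hkρ, if_neg hek, add_zero, hv0 k hek]
        exact ⟨fun h => eq_of_mem_digits hn (hL k (Finset.mem_Icc.2 ⟨hk1, hkρ⟩)) (Or.inl rfl)
          (by rw [h, map_zero]), fun h => by rw [h, map_zero]⟩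
      by_cases hz : Lam k = v k <;> simp [hk0, hkρ, hek, hiff, hz, horb]
    · have hne : toField f (quadCoeff e ρ lam Lam k) ≠ 0 := by
        rw [quadCoeff, if_neg hkρ, if_pos hek, zero_add, map_pow]
        exact hlk
      simp [hkρ, hek, hne]
    · have hz : toField f (quadCoeff e ρ lam Lam k) = 0 := by
        rw [quadCoeff, if_neg hkρ, if_neg hek, zero_add, map_zero]
      simp [hk0, hkρ, hek, hz]
  have hsum := Finset.sum_congr rfl hQ
  rw [Finset.sum_add_distrib, Finset.sum_add_distrib, Finset.sum_add_distrib,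
    ← Finset.sum_filter (fun k => (k ≤ ρ - 1 ∧ ¬ e ∣ k) ∧ Lam k = v k),
    ← Finset.sum_filter (fun k => (k ≤ ρ - 1 ∧ e ∣ k) ∧ Lam k = v k),
    ← Finset.sum_filter (fun k => k ≤ ρ - 1 ∧ ¬ e ∣ k), ← Finset.sum_filter (e ∣ ·),
    Finset.sum_const, Finset.sum_const, Finset.sum_const,
    show (Finset.Icc 1 (n / 2)).filter (fun k => (k ≤ ρ - 1 ∧ ¬ e ∣ k) ∧ Lam k = v k) =
      (setA e ρ).filter fun k => Lam k = v k by
        ext k; simp only [setA, Finset.mem_filter, Finset.mem_Icc]; grind,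
    show (Finset.Icc 1 (n / 2)).filter (fun k => (k ≤ ρ - 1 ∧ e ∣ k) ∧ Lam k = v k) =
      (setB e ρ).filter fun k => Lam k = v k by
        ext k; simp only [setB, Finset.mem_filter, Finset.mem_Icc]; grind,
    show (Finset.Icc 1 (n / 2)).filter (fun k => k ≤ ρ - 1 ∧ ¬ e ∣ k) = setA e ρ by
        ext k; simp only [setA, Finset.mem_filter, Finset.mem_Icc]; grind,
    hj, hl, smul_eq_mul, smul_eq_mul, smul_eq_mul] at hsum
  rw [linearSpan_s_eq_card hf hdeg he hm hρ hρn hβ ha, ← hndef,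
    card_filter_quadIndex n (fun k => k = 0 ∨ toField f (quadCoeff e ρ lam Lam k) ≠ 0),
    sum_range_succ_eq_add_sum_Icc, if_pos (Or.inl rfl), orbitSize_of_lt (by omega)]
  linarith

theorem linearSpan_sExtra {e m : ℕ} (hf : IsBasicPrimitive f) (hdeg : f.natDegree = e * m)
    (he : 2 ≤ e) (hm : 2 ≤ m) {β : (GR f)ˣ}
    (hβ : Subgroup.zpowers β = groupC (GR f) (e * m)) {a : ℕ → ZMod 4}
    (ha : Represents a (sExtra e m (β : GR f))) : linearSpan a = e * m := by
  have : Fact (Irreducible (f.map mod2)) := ⟨hf.2.1⟩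
  have hn : 4 ≤ e * m := Nat.mul_le_mul he hm
  have hβd := mem_digits_of_zpowers_eq hβ
  have hinj := pow_quadExp_injOn hf (by omega) (hdeg ▸ hβ)
  have hdp := fun x hx k => digits_pow_mem (f := f) (x := x) hf hx k
  have hspan := @linearSpan_eq_card f hf ℕ
  have htr := two_mul_tr hf
  rw [hdeg] at hinj hdp hspan htr
  have hmem : ∀ i < e * m, (⟨0, i⟩ : Σ _ : ℕ, ℕ) ∈ quadIndex (e * m) := fun i hi =>
    mem_quadIndex.2 ⟨Nat.zero_le _, by rw [orbitSize_of_lt (by dsimp only; omega)]; exact hi⟩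
  rw [← Finset.card_range (e * m)]
  refine hspan (γ := fun i => (β : GR f) ^ quadExp (e * m) 0 i) (c := fun _ => 2)
    ?_ ?_ ?_ ?_ ?_
  · intro i hi i' hi' h
    have := hinj (hmem i (Finset.mem_range.1 hi)) (hmem i' (Finset.mem_range.1 hi'))
      (congrArg (toField f) h)
    simpa using this
  · exact fun x _ => hdp _ hβd _
  · intro i hi
    obtain ⟨-, h⟩ := mem_quadIndex.1 (hmem i (Finset.mem_range.1 hi))
    obtain ⟨i', hi', h⟩ := exists_pow_quadExp_eq_sq (by omega) hβd (Nat.zero_le _) h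
    exact ⟨i', Finset.mem_range.2 (hi'.trans_le (orbitSize_le _ _)), h⟩
  -- All coefficients equal 2, which is not a unit; being nonzero is all that `linearSpan_eq_card`
  -- needs.
  · intro i _ h
    have := two_mul_eq_zero hf.1 (x := (1 : GR f)) (by rw [mul_one]; exact h)
    rw [map_one] at this
    exact one_ne_zero this
  · intro t
    rw [ha t, sExtra, htr]
    refine Finset.sum_congr rfl fun i hi => ?_
    rw [quadExp_zero (Finset.mem_range.1 hi)]
    ring

end Span

end QuadSeq

theorem theorem2 (e m ρ : ℕ) (he : 2 ≤ e) (hm : 2 ≤ m) (hρ : 1 ≤ ρ) (hρn : ρ < e * m / 2)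
    (f : (ZMod 4)[X]) (hf : IsBasicPrimitive f) (hdeg : f.natDegree = e * m)
    (β : (GR f)ˣ) (hβ : Subgroup.zpowers β = groupC (GR f) (e * m))
    (lam : GR f) (hlam : lam ∈ subGR (GR f) (e * m) e)
    (hlam0 : red (GR f) lam ≠ 0) (hlam1 : red (GR f) lam ≠ 1) :
    (∀ j l : ℕ, j ≤ (setA e ρ).card → l ≤ (setB e ρ).card →
      (∀ (lam0 : GR f) (Lam : ℕ → GR f), HasType e m ρ lam j l lam0 Lam →
        ∃ a : ℕ → ZMod 4, Represents a (s e m ρ (β : GR f) lam lam0 Lam) ∧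
          (linearSpan a : ℚ) = ((e * m : ℕ) : ℚ) *
            (((m : ℚ) - 1) / 2 + ρ - 1 - (((ρ - 1) / e : ℕ) : ℚ) + 1 - j - l)) ∧
      {a : ℕ → ZMod 4 | ∃ (lam0 : GR f) (Lam : ℕ → GR f), HasType e m ρ lam j l lam0 Lam ∧
          Represents a (s e m ρ (β : GR f) lam lam0 Lam)}.ncard =
        (ρ - 1 - (ρ - 1) / e).choose j * ((ρ - 1) / e).choose l * 2 ^ (e * m) *
          (2 ^ (e * m) - 1) ^ (ρ - 1 - j - l)) ∧
    ∃ a : ℕ → ZMod 4, Represents a (sExtra e m (β : GR f)) ∧ linearSpan a = e * m := by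
  have hlam' : toField f lam ≠ 0 := fun h =>
    hlam0 (by rw [← map_zero (red (GR f)), red_eq_red_iff, h, map_zero])
  have hB := card_setB (show 0 < e by omega) ρ
  have hAB := card_setA_add_card_setB e ρ
  have hA : (setA e ρ).card = ρ - 1 - (ρ - 1) / e := by omega
  refine ⟨fun j l _ _ => ⟨fun lam0 Lam ht => ?_, ?_⟩, ?_⟩
  · obtain ⟨a, ha⟩ := exists_represents_s (ρ := ρ) hf hdeg (β : GR f) lam lam0 Lam
    refine ⟨a, ha, ?_⟩
    have h1 := linearSpan_s_add hf hdeg he hm hρ hρn hβ hlam' ht ha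
    have h2 := two_mul_sum_orbitSize (show 0 < e by omega) hm
    rw [hB] at hAB
    -- The floor quotient is needed only through `|A| + q = ρ - 1`, so it can be an arbitrary
    -- natural number when passing to `ℚ`.
    generalize (ρ - 1) / e = q at hAB ⊢
    qify [hρ, show 1 ≤ m by omega] at h1 h2 hAB
    push_cast
    linear_combination h1 + h2 / 2 + (e * m : ℚ) * hAB
  · rw [ncard_sequences hf hdeg he hm hρ hρn hβ, hAB, hA, hB]
  · obtain ⟨a, ha⟩ := exists_represents_sExtra hf hdeg (β : GR f)
    exact ⟨a, ha, linearSpan_sExtra hf hdeg he hm hβ ha⟩
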